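/- Let $\mathbb S=\mathbb R/2\pi\mathbb Z$ with arc length, let $m>1$ and $K\ge 0$, and put $J*v(\theta)=K\int_0^{2\pi}\sin(\theta-\varphi)\,v(\varphi)\,d\varphi$. Let $u\in C^1([0,\infty),L^m(\mathbb S))$ be a weak solution of $$\partial_t u=\partial_\theta^2(u^m)+\partial_\theta\big(u\,(J*u)\big)\quad\text{on }[0,\infty)\times\mathbb S,$$ that is, for every $\phi\in C^\infty(\mathbb S)$ and every $t\ge 0$, $$\int_0^{2\pi}u(t)\phi\,d\theta=\int_0^{2\pi}u(0)\phi\,d\theta+\int_0^t\!\int_0^{2\pi}\Big(u(s)^m\,\phi''-u(s)\,(J*u(s))\,\phi'\Big)\,d\theta\,ds .$$ Assume that $u(t,\cdot)\ge 0$ and $\int_{\mathbb S}u(t,\theta)\,d\theta=1$ for all $t\ge 0$, and that the initial value $u(0,\cdot)$ is even. Let $C$ be the set of even nonnegative $\hat u\in L^\infty(\mathbb S)$ with $\int_{\mathbb S}\hat u\,d\theta=1$ whose power $\hat u^{m-1}$ has a weak derivative $\partial_\theta(\hat u^{m-1})\in L^\infty(\mathbb S)$ and which satisfy $$\hat u(\theta)\Big(\tfrac{m}{m-1}\,\partial_\theta(\hat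 u^{m-1})(\theta)+K\,\hat x_1\sin\theta\Big)=0\quad\text{for a.e. }\theta,\qquad \hat x_1=\int_{\mathbb S}\hat u(\theta)\cos\theta\,d\theta .$$ Then $$\operatorname{dist}_{L^\infty}(u(t),C)=\inf_{\hat u\in C}\|u(t)-\hat u\|_{L^\infty(\mathbb S)}\longrightarrow 0\qquad\text{as }t\to+\infty .$$ -/

import Mathlib

open Real MeasureTheory Filter Topology

/-- The circle `𝕊 = ℝ / 2πℤ`; its `volume` is arc length, of total mass `2π`.
A real number `θ` is mapped to its class `(θ : Circle2Pi)`. -/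
abbrev Circle2Pi : Type := AddCircle (2 * π)

instance fact_zero_lt_two_pi : Fact (0 < 2 * π) := ⟨two_pi_pos⟩

/-- For `1 < m` the space `L^m(𝕊)` is a normed space. -/
instance fact_one_le_ofReal (m : ℝ) [hm : Fact (1 < m)] : Fact (1 ≤ ENNReal.ofReal m) :=
  ⟨ENNReal.one_le_ofReal.mpr hm.out.le⟩

/-- The Lebesgue space `L^m(𝕊)` of (classes of) real functions. -/
abbrev LmCircle (m : ℝ) : Type :=
  Lp ℝ (ENNReal.ofReal m) (volume : Measure Circle2Pi)

/-- Smooth `2π`-periodic functions of a real variable, i.e. smooth functions on the circle. -/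
def IsPeriodicTest (φ : ℝ → ℝ) : Prop :=
  ContDiff ℝ ((⊤ : ℕ∞) : WithTop ℕ∞) φ ∧ Function.Periodic φ (2 * π)

/-- `(J ∗ v)(θ) = K ∫_0^{2π} sin (θ - φ) v(φ) dφ`. -/
noncomputable def couplingConv (K : ℝ) (v : Circle2Pi → ℝ) (θ : ℝ) : ℝ :=
  K * ∫ φ in (0 : ℝ)..(2 * π), sin (θ - φ) * v (φ : Circle2Pi)

/-- The first cosine moment `x₁(v) = ∫_0^{2π} v(θ) cos θ dθ`. -/
noncomputable def cosMoment (v : Circle2Pi → ℝ) : ℝ :=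
  ∫ θ in (0 : ℝ)..(2 * π), v (θ : Circle2Pi) * cos θ

/-- `v` is even, nonnegative and of mass one (almost everywhere on the circle). -/
structure IsEvenDensity (v : Circle2Pi → ℝ) : Prop where
  nonneg : ∀ᵐ θ, 0 ≤ v θ
  mass : ∫ θ, v θ = 1
  even : ∀ᵐ θ, v (-θ) = v θ

/-- Weak (distributional) solutions on `[0, ∞)` of
`∂ₜ u = ∂_θ² (u^m) + ∂_θ (u (J ∗ u))` on the circle, with initial value `u 0`: the equation is
tested against smooth functions on the circle and integrated in time. (For the curves that
are continuous in time with values in `L^m` this is the same as testing against smooth functions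
of `(t, θ)`.) -/
def IsWeakSolution (m K : ℝ) (u : ℝ → LmCircle m) : Prop :=
  ∀ φ : ℝ → ℝ, IsPeriodicTest φ → ∀ t : ℝ, 0 ≤ t →
    ∫ θ in (0 : ℝ)..(2 * π), u t (θ : Circle2Pi) * φ θ =
      (∫ θ in (0 : ℝ)..(2 * π), u 0 (θ : Circle2Pi) * φ θ) +
        ∫ s in (0 : ℝ)..t, ∫ θ in (0 : ℝ)..(2 * π),
          ((u s (θ : Circle2Pi)) ^ m * deriv (deriv φ) θ
            - u s (θ : Circle2Pi) * couplingConv K (u s) θ * deriv φ θ)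

/-- `g` is the weak derivative of `f` on the circle. -/
def IsWeakDerivCircle (f g : Circle2Pi → ℝ) : Prop :=
  ∀ φ : ℝ → ℝ, IsPeriodicTest φ →
    ∫ θ in (0 : ℝ)..(2 * π), f (θ : Circle2Pi) * deriv φ θ =
      -∫ θ in (0 : ℝ)..(2 * π), g (θ : Circle2Pi) * φ θ

/-- The even densities `w ∈ L^∞` with `∂_θ (w^(m-1)) ∈ L^∞` that solve
`w (m/(m-1) ∂_θ (w^(m-1)) + K x₁(w) sin θ) = 0` almost everywhere. -/
def equilibriumSet (m K : ℝ) : Set (Circle2Pi → ℝ) :=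
  {w | IsEvenDensity w ∧ MemLp w ⊤ volume ∧
    ∃ g : Circle2Pi → ℝ, MemLp g ⊤ volume ∧
      IsWeakDerivCircle (fun θ => w θ ^ (m - 1)) g ∧
      ∀ᵐ θ : ℝ, w (θ : Circle2Pi) *
        (m / (m - 1) * g (θ : Circle2Pi) + K * cosMoment w * sin θ) = 0}

/-! Write the equation as `∂ₜu = ∂_θ F` with flux `F = ∂_θ(u^m) + u (J ∗ u)`, normalized to mean
zero. Because the curve is C¹ in time with values in `L^m`, the equation holds in the sense of
distributions at each time. Then `u(t)^m` is, up to a constant, the primitive of `F - u (J ∗ u)`, so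
`u(t)` has a continuous representative whose power `m` is C¹ (`exists_profile`,
`IsWeakSolution.exists_isFlow`). The norm of the velocity in `H⁻¹` is the `L²` norm of the flux,
denoted `Φ` here, and it bounds the density: `u ≤ 1 + K + 3Φ` (`IsProfile.le_bound`).

Two mechanisms force `Φ → 0`. The first is dissipation: formally `d/dt E = -∫ F²/u`, hence `E`
decreases at rate at least `Φ² / (1 + K + 3Φ)` (`IsFlow.freeEnergy_add_integral_le`). As `E` is
bounded below, the dissipation over unit time windows tends to zero, so every late window contains a
time of small flux. The second is stability in `H⁻¹` (`IsFlow.norm_sq_primCLM_sub_le`): diffusion is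
monotone there, while the mean field term costs a Grönwall factor with rate controlled by `Φ`.
Applied to the solution and its time shift, and divided by the squared shift, this says that `Φ`
itself satisfies a Grönwall bound (`IsFlow.norm_sq_flux_le`). Smallness at one time of a window
therefore persists to its end, and `Φ → 0` (`IsFlow.tendsto_norm_flux`). Applied to the solution and
its mirror image, the same stability shows that evenness persists (`IsFlow.ae_reflect_eq`).

Bounded flux makes the functions `u(t)^m` equicontinuous. Along any sequence of times tending to
infinity, Arzelà–Ascoli gives a uniformly convergent subsequence; its limit has zero flux and is
even, so it belongs to `C` (`exists_subseq_tendsto_stationary`,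
`IsStationaryProfile.lift_mem_equilibriumSet`). Since every sequence has such a subsequence, the
distance to `C` tends to zero, without any classification of the equilibria or convergence to a
single one. -/

/-! ### Mean-zero primitives and integration by parts -/

/-- The primitive of `f` on `[0, 2π]` that has mean zero. -/
noncomputable def normPrim (f : ℝ → ℝ) (θ : ℝ) : ℝ :=
  (∫ x in (0 : ℝ)..θ, f x) - (2 * π)⁻¹ * ∫ y in (0 : ℝ)..(2 * π), ∫ x in (0 : ℝ)..y, f x

theorem continuous_normPrim {f : ℝ → ℝ} (hf : ∀ a b, IntervalIntegrable f volume a b) :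
    Continuous (normPrim f) :=
  (intervalIntegral.continuous_primitive hf 0).sub continuous_const

theorem integral_normPrim {f : ℝ → ℝ} (hf : ∀ a b, IntervalIntegrable f volume a b) :
    ∫ θ in (0 : ℝ)..(2 * π), normPrim f θ = 0 := by
  unfold normPrim
  rw [intervalIntegral.integral_sub
    ((intervalIntegral.continuous_primitive hf 0).intervalIntegrable _ _)
    (continuous_const.intervalIntegrable _ _), intervalIntegral.integral_const]
  have := two_pi_pos.ne'
  simp only [smul_eq_mul, sub_zero]
  field_simp
  ring

theorem normPrim_sub_normPrim {f : ℝ → ℝ} (hf : ∀ a b, IntervalIntegrable f volume a b)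
    (a b : ℝ) : normPrim f b - normPrim f a = ∫ x in a..b, f x := by
  unfold normPrim
  rw [← intervalIntegral.integral_interval_sub_left (hf 0 b) (hf 0 a)]
  ring

theorem periodic_normPrim {f : ℝ → ℝ} (hf : ∀ a b, IntervalIntegrable f volume a b)
    (hp : Function.Periodic f (2 * π)) (h0 : ∫ θ in (0 : ℝ)..(2 * π), f θ = 0) :
    Function.Periodic (normPrim f) (2 * π) := fun x => by
  have := normPrim_sub_normPrim hf x (x + 2 * π)
  rw [hp.intervalIntegral_add_eq x 0, zero_add, h0] at this
  linarith

theorem hasDerivAt_normPrim {f : ℝ → ℝ} (hf : Continuous f) (θ : ℝ) :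
    HasDerivAt (normPrim f) (f θ) θ :=
  (intervalIntegral.integral_hasDerivAt_right (hf.intervalIntegrable _ _)
    hf.stronglyMeasurable.stronglyMeasurableAtFilter hf.continuousAt).sub_const _

theorem normPrim_add {f g : ℝ → ℝ} (hf : ∀ a b, IntervalIntegrable f volume a b)
    (hg : ∀ a b, IntervalIntegrable g volume a b) (θ : ℝ) :
    normPrim (fun x => f x + g x) θ = normPrim f θ + normPrim g θ := by
  have h : ∀ y, ∫ x in (0 : ℝ)..y, (f x + g x) = (∫ x in (0 : ℝ)..y, f x) + ∫ x in (0 : ℝ)..y, g x :=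
    fun y => intervalIntegral.integral_add (hf 0 y) (hg 0 y)
  simp only [normPrim, h]
  rw [intervalIntegral.integral_add
    ((intervalIntegral.continuous_primitive hf 0).intervalIntegrable _ _)
    ((intervalIntegral.continuous_primitive hg 0).intervalIntegrable _ _)]
  ring

theorem normPrim_const_mul (c : ℝ) (f : ℝ → ℝ) (θ : ℝ) :
    normPrim (fun x => c * f x) θ = c * normPrim f θ := by
  simp only [normPrim, intervalIntegral.integral_const_mul]
  ring

theorem normPrim_sub {f g : ℝ → ℝ} (hf : ∀ a b, IntervalIntegrable f volume a b)
    (hg : ∀ a b, IntervalIntegrable g volume a b) (θ : ℝ) :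
    normPrim (fun x => f x - g x) θ = normPrim f θ - normPrim g θ := by
  have h := normPrim_add hf (fun a b => (hg a b).const_mul (-1)) θ
  rw [normPrim_const_mul] at h
  have h' : (fun x => f x + -1 * g x) = fun x => f x - g x := by ext; ring
  rw [h'] at h
  rw [h]; ring

theorem normPrim_congr_ae {f g : ℝ → ℝ} (h : ∀ᵐ x, f x = g x) (θ : ℝ) :
    normPrim f θ = normPrim g θ := by
  have h' : ∀ y, ∫ x in (0 : ℝ)..y, f x = ∫ x in (0 : ℝ)..y, g x := fun y =>
    intervalIntegral.integral_congr_ae (h.mono fun x hx _ => hx)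
  simp only [normPrim, h']

/-- Integration by parts against the mean-zero primitive of an integrable function. -/
theorem integral_mul_eq_neg_integral_normPrim_mul {f g g' : ℝ → ℝ}
    (hf : ∀ a b, IntervalIntegrable f volume a b) (h0 : ∫ θ in (0 : ℝ)..(2 * π), f θ = 0)
    (hg : ∀ x, HasDerivAt g (g' x) x) (hg' : Continuous g') :
    ∫ θ in (0 : ℝ)..(2 * π), f θ * g θ = -(∫ θ in (0 : ℝ)..(2 * π), normPrim f θ * g' θ) +
      normPrim f 0 * (g (2 * π) - g 0) := by
  have hdg : deriv g = g' := funext fun x => (hg x).deriv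
  have hgc : ContDiff ℝ 1 g := contDiff_one_iff_deriv.2
    ⟨fun x => (hg x).differentiableAt, hdg ▸ hg'⟩
  -- The function `f` is only integrable, so its primitive is merely absolutely continuous and the
  -- classical integration by parts does not apply.
  have hF := (hf 0 (2 * π)).absolutelyContinuousOnInterval_intervalIntegral (c := 0) (by simp)
  have hG : AbsolutelyContinuousOnInterval g 0 (2 * π) :=
    hgc.contDiffOn.absolutelyContinuousOnInterval
  have key := hF.integral_mul_deriv_eq_deriv_mul hG
  rw [hdg, intervalIntegral.integral_same, h0] at key
  have hd : ∫ x in (0 : ℝ)..(2 * π), deriv (fun y => ∫ t in (0 : ℝ)..y, f t) x * g x =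
      ∫ x in (0 : ℝ)..(2 * π), f x * g x := by
    apply intervalIntegral.integral_congr_ae
    filter_upwards [(hf 0 (2 * π)).ae_hasDerivAt_integral] with x hx hx'
    rw [(hx (Set.uIoc_subset_uIcc hx') 0 (by simp)).deriv]
  rw [hd] at key
  have hc := intervalIntegral.continuous_primitive hf 0
  have hFtc : ∫ x in (0 : ℝ)..(2 * π), g' x = g (2 * π) - g 0 :=
    intervalIntegral.integral_eq_sub_of_hasDerivAt (fun x _ => hg x) (hg'.intervalIntegrable _ _)
  have : ∫ θ in (0 : ℝ)..(2 * π), normPrim f θ * g' θ =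
      (∫ θ in (0 : ℝ)..(2 * π), (∫ t in (0 : ℝ)..θ, f t) * g' θ) +
        normPrim f 0 * (g (2 * π) - g 0) := by
    have hi1 : IntervalIntegrable (fun θ => (∫ t in (0 : ℝ)..θ, f t) * g' θ) volume 0 (2 * π) :=
      (hc.mul hg').intervalIntegrable _ _
    have hi2 : IntervalIntegrable (fun θ => normPrim f 0 * g' θ) volume 0 (2 * π) :=
      (continuous_const.mul hg').intervalIntegrable _ _
    rw [← hFtc, ← intervalIntegral.integral_const_mul, ← intervalIntegral.integral_add hi1 hi2]
    refine intervalIntegral.integral_congr fun θ _ => ?_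
    simp only [normPrim, intervalIntegral.integral_same]
    ring
  rw [this]
  linarith

theorem integral_mul_eq_neg_of_periodic {f g g' : ℝ → ℝ}
    (hf : ∀ a b, IntervalIntegrable f volume a b) (h0 : ∫ θ in (0 : ℝ)..(2 * π), f θ = 0)
    (hg : ∀ x, HasDerivAt g (g' x) x) (hg' : Continuous g') (hp : Function.Periodic g (2 * π)) :
    ∫ θ in (0 : ℝ)..(2 * π), f θ * g θ = -∫ θ in (0 : ℝ)..(2 * π), normPrim f θ * g' θ := by
  have := hp 0
  rw [zero_add] at this
  rw [integral_mul_eq_neg_integral_normPrim_mul hf h0 hg hg', this]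
  ring

/-- Integration by parts for continuously differentiable periodic functions. -/
theorem integral_deriv_mul_of_periodic {f f' g g' : ℝ → ℝ}
    (hf : ∀ x, HasDerivAt f (f' x) x) (hf' : Continuous f') (hfp : Function.Periodic f (2 * π))
    (hg : ∀ x, HasDerivAt g (g' x) x) (hg' : Continuous g') (hp : Function.Periodic g (2 * π)) :
    ∫ θ in (0 : ℝ)..(2 * π), f' θ * g θ = -∫ θ in (0 : ℝ)..(2 * π), f θ * g' θ := by
  have h := intervalIntegral.integral_mul_deriv_eq_deriv_mul (a := 0) (b := 2 * π)
    (fun x _ => hf x) (fun x _ => hg x) (hf'.intervalIntegrable _ _) (hg'.intervalIntegrable _ _)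
  have h1 := hp 0
  have h2 := hfp 0
  rw [zero_add] at h1 h2
  rw [h1, h2] at h
  linarith

/-! ### Passage between the circle and the line; uniqueness of Fourier coefficients -/

theorem ae_coe_circle {p : Circle2Pi → Prop} (h : ∀ᵐ x, p x) : ∀ᵐ θ : ℝ, p (θ : Circle2Pi) := by
  have h1 : ∀ n : ℤ, ∀ᵐ θ : ℝ ∂volume.restrict (Set.Ioc (n • (2 * π)) (n • (2 * π) + 2 * π)),
      p (θ : Circle2Pi) := fun n =>
    (AddCircle.measurePreserving_mk (2 * π) (n • (2 * π))).quasiMeasurePreserving.ae h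
  have h2 : (⋃ n : ℤ, Set.Ioc (n • (2 * π)) (n • (2 * π) + 2 * π)) = Set.univ := by
    have := iUnion_Ioc_zsmul two_pi_pos
    simpa [add_smul] using this
  rw [← Measure.restrict_univ (μ := (volume : Measure ℝ)), ← h2]
  exact (ae_restrict_iUnion_iff _ _).2 h1

theorem ae_circle_of_ae_restrict {p : Circle2Pi → Prop}
    (h1 : ∀ᵐ θ : ℝ ∂volume.restrict (Set.Ioc (0 : ℝ) (0 + 2 * π)), p (θ : Circle2Pi)) :
    ∀ᵐ x, p x := by
  have mp' := AddCircle.measurePreserving_equivIoc (2 * π) (a := 0)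
  have h2 : ∀ᵐ y : Set.Ioc (0 : ℝ) (0 + 2 * π) ∂Measure.comap Subtype.val volume,
      p ((y : ℝ) : Circle2Pi) :=
    (ae_restrict_iff_subtype measurableSet_Ioc).1 h1
  have h3 := mp'.quasiMeasurePreserving.ae h2
  filter_upwards [h3] with x hx
  have hx2 : (((AddCircle.equivIoc (2 * π) 0 x : ℝ)) : Circle2Pi) = x :=
    (AddCircle.equivIoc (2 * π) 0).symm_apply_apply x
  rwa [hx2] at hx

theorem periodic_coe_circle {α : Type*} (f : Circle2Pi → α) :
    Function.Periodic (fun θ : ℝ => f (θ : Circle2Pi)) (2 * π) := fun x => by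
  simp

theorem intervalIntegrable_coe_circle {E : Type*} [NormedAddCommGroup E] {f : Circle2Pi → E}
    (hf : Integrable f) (a b : ℝ) :
    IntervalIntegrable (fun θ : ℝ => f (θ : Circle2Pi)) volume a b := by
  refine (periodic_coe_circle f).intervalIntegrable₀ two_pi_pos.ne' ?_ a b
  rw [intervalIntegrable_iff_integrableOn_Ioc_of_le two_pi_pos.le]
  have := (AddCircle.measurePreserving_mk (2 * π) 0).integrable_comp_of_integrable hf
  rw [zero_add] at this
  exact this

theorem integral_circle {E : Type*} [NormedAddCommGroup E] [NormedSpace ℝ E] (f : Circle2Pi → E) :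
    ∫ x, f x = ∫ θ in (0 : ℝ)..(2 * π), f (θ : Circle2Pi) := by
  rw [← AddCircle.intervalIntegral_preimage (2 * π) 0, zero_add]

/-- An integrable function on the circle that is orthogonal to all nonconstant trigonometric
monomials is constant. -/
theorem ae_eq_const_of_forall_integral_cos_sin {f : Circle2Pi → ℝ} (hf : Integrable f)
    (hc : ∀ n : ℕ, n ≠ 0 → ∫ θ in (0 : ℝ)..(2 * π), f (θ : Circle2Pi) * cos (n * θ) = 0)
    (hs : ∀ n : ℕ, n ≠ 0 → ∫ θ in (0 : ℝ)..(2 * π), f (θ : Circle2Pi) * sin (n * θ) = 0) :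
    ∃ c : ℝ, ∀ᵐ θ : ℝ, f (θ : Circle2Pi) = c := by
  -- Subtracting the mean also kills the zeroth Fourier mode, so that all modes of `g` vanish.
  set c : ℝ := (2 * π)⁻¹ * ∫ x, f x with hcdef
  refine ⟨c, ?_⟩
  have hT := two_pi_pos.ne'
  set g : Circle2Pi → ℂ := fun x => ((f x - c : ℝ) : ℂ) with hg
  have hgi : Integrable g := ((hf.sub (integrable_const c)).ofReal)
  have hψi : ∀ ψ : C(Circle2Pi, ℂ), Integrable (fun x => ψ x * g x) := fun ψ =>
    hgi.bdd_mul (c := ‖ψ‖) ψ.continuous.aestronglyMeasurable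
      (Eventually.of_forall fun x => ψ.norm_coe_le_norm x)
  -- the functional `ψ ↦ ∫ ψ g`
  let L : C(Circle2Pi, ℂ) →ₗ[ℂ] ℂ :=
    { toFun := fun ψ => ∫ x, ψ x * g x
      map_add' := fun a b => by
        rw [← integral_add (hψi a) (hψi b)]
        simp [add_mul]
      map_smul' := fun a b => by
        simp [← integral_const_mul, mul_assoc] }
  let L' : C(Circle2Pi, ℂ) →L[ℂ] ℂ := L.mkContinuous (∫ x, ‖g x‖) (fun ψ => by
    rw [mul_comm (∫ x, ‖g x‖) ‖ψ‖, ← integral_const_mul]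
    refine (norm_integral_le_integral_norm _).trans ?_
    refine integral_mono (hψi ψ).norm (hgi.norm.const_mul _) fun x => ?_
    simp only [norm_mul]
    gcongr
    exact ψ.norm_coe_le_norm x)
  have hL' : ∀ ψ, L' ψ = ∫ x, ψ x * g x := fun ψ => rfl
  have hmono : ∀ n : ℤ, L' (fourier n) = 0 := by
    intro n
    rw [hL', integral_circle]
    by_cases hn : n = 0
    · subst hn
      simp only [fourier_zero, one_mul, hg]
      rw [intervalIntegral.integral_ofReal, intervalIntegral.integral_sub
        (intervalIntegrable_coe_circle hf _ _) (by simp), ← integral_circle f]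
      simp [hcdef]
      field_simp
      simp
    · have hexp : ∀ θ : ℝ, fourier n (θ : Circle2Pi) * g (θ : Circle2Pi) =
          (((f (θ : Circle2Pi) - c) * cos (n * θ) : ℝ) : ℂ) +
            Complex.I * (((f (θ : Circle2Pi) - c) * sin (n * θ) : ℝ) : ℂ) := by
        intro θ
        rw [fourier_coe_apply]
        have : (2 * (π : ℂ) * Complex.I * n * θ / ((2 * π : ℝ) : ℂ)) =
            ((n * θ : ℝ) : ℂ) * Complex.I := by
          have : (π : ℂ) ≠ 0 := by exact_mod_cast pi_ne_zero
          push_cast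
          field_simp
        rw [this, Complex.exp_mul_I, ← Complex.ofReal_cos, ← Complex.ofReal_sin]
        simp only [hg]
        push_cast
        ring
      have hfi := intervalIntegrable_coe_circle hf 0 (2 * π)
      have hfc : ∀ {h : ℝ → ℝ}, Continuous h → IntervalIntegrable
          (fun θ : ℝ => f (θ : Circle2Pi) * h θ) volume 0 (2 * π) := fun hh =>
        hfi.mul_continuousOn hh.continuousOn
      have hcn : ∫ θ in (0 : ℝ)..(2 * π), cos (n * θ) = 0 := by
        have hn' : (n : ℝ) ≠ 0 := by exact_mod_cast hn
        rw [intervalIntegral.integral_comp_mul_left _ hn', integral_cos]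
        have := sin_int_mul_pi (n * 2)
        push_cast at this
        rw [← mul_assoc, this]
        simp
      have hsn : ∫ θ in (0 : ℝ)..(2 * π), sin (n * θ) = 0 := by
        have hn' : (n : ℝ) ≠ 0 := by exact_mod_cast hn
        rw [intervalIntegral.integral_comp_mul_left _ hn', integral_sin]
        have := cos_int_mul_two_pi n
        rw [this]
        simp
      have hcf : ∫ θ in (0 : ℝ)..(2 * π), f (θ : Circle2Pi) * cos (n * θ) = 0 := by
        have h1 := hc n.natAbs (by simpa using hn)
        rw [Nat.cast_natAbs] at h1
        rcases abs_choice n with h | h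
        · rwa [h] at h1
        · rw [h] at h1
          simpa using h1
      have hsf : ∫ θ in (0 : ℝ)..(2 * π), f (θ : Circle2Pi) * sin (n * θ) = 0 := by
        have h1 := hs n.natAbs (by simpa using hn)
        rw [Nat.cast_natAbs] at h1
        rcases abs_choice n with h | h
        · rwa [h] at h1
        · rw [h] at h1
          simpa using h1
      have h1 : ∫ θ in (0 : ℝ)..(2 * π), (f (θ : Circle2Pi) - c) * cos (n * θ) = 0 := by
        simp only [sub_mul]
        rw [intervalIntegral.integral_sub (hfc (by fun_prop))
          (Continuous.intervalIntegrable (by fun_prop) _ _), intervalIntegral.integral_const_mul,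
          hcn, hcf]
        simp
      have h2 : ∫ θ in (0 : ℝ)..(2 * π), (f (θ : Circle2Pi) - c) * sin (n * θ) = 0 := by
        simp only [sub_mul]
        rw [intervalIntegral.integral_sub (hfc (by fun_prop))
          (Continuous.intervalIntegrable (by fun_prop) _ _), intervalIntegral.integral_const_mul,
          hsn, hsf]
        simp
      have hi : ∀ {h : ℝ → ℝ}, Continuous h → IntervalIntegrable
          (fun θ : ℝ => (((f (θ : Circle2Pi) - c) * h θ : ℝ) : ℂ)) volume 0 (2 * π) := by
        intro h hh
        have : IntervalIntegrable (fun θ : ℝ => (f (θ : Circle2Pi) - c) * h θ) volume 0 (2 * π) :=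
          (hfi.sub (by simp)).mul_continuousOn hh.continuousOn
        exact ⟨this.1.ofReal, this.2.ofReal⟩
      simp only [hexp]
      rw [intervalIntegral.integral_add (hi (by fun_prop)) ((hi (by fun_prop)).const_mul _),
        intervalIntegral.integral_const_mul, intervalIntegral.integral_ofReal,
        intervalIntegral.integral_ofReal, h1, h2]
      simp
  -- The kernel of the functional is closed and contains the trigonometric polynomials, which are
  -- uniformly dense.
  have hzero : ∀ ψ, L' ψ = 0 := by
    have hle : (Submodule.span ℂ (Set.range (fourier (T := 2 * π)))).topologicalClosure ≤
        LinearMap.ker (L' : C(Circle2Pi, ℂ) →ₗ[ℂ] ℂ) := by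
      refine Submodule.topologicalClosure_minimal _ ?_ L'.isClosed_ker
      rw [Submodule.span_le]
      rintro _ ⟨n, rfl⟩
      exact hmono n
    rw [span_fourier_closure_eq_top] at hle
    exact fun ψ => hle Submodule.mem_top
  -- test with smooth functions supported in one period
  have hloc : ∀ᵐ θ : ℝ, θ ∈ Set.Ioo 0 (2 * π) → f (θ : Circle2Pi) - c = 0 := by
    refine isOpen_Ioo.ae_eq_zero_of_integral_contDiff_smul_eq_zero ?_ ?_
    · refine LocallyIntegrable.locallyIntegrableOn ?_ _
      refine locallyIntegrable_iff.2 fun k hk => ?_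
      obtain ⟨a, b, hab⟩ : ∃ a b : ℝ, k ⊆ Set.Ioc a b := by
        obtain ⟨r, hr⟩ := hk.isBounded.subset_closedBall 0
        refine ⟨-r - 1, r + 1, fun x hx => ?_⟩
        have := hr hx
        rw [Metric.mem_closedBall, dist_zero_right, norm_eq_abs, abs_le] at this
        constructor <;> linarith
      have := (intervalIntegrable_coe_circle (hf.sub (integrable_const c)) a b).1
      exact this.mono_set hab
    · intro h hh hcs hsupp
      have h0 : h 0 = 0 := by
        by_contra hne
        have := hsupp (subset_tsupport _ hne)
        simp at this
      have h2 : h (0 + 2 * π) = 0 := by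
        by_contra hne
        have := hsupp (subset_tsupport _ hne)
        simp at this
      -- The bump vanishes at both ends of the period, hence descends to a continuous function on
      -- the circle.
      let H : C(Circle2Pi, ℂ) := ⟨AddCircle.liftIco (2 * π) 0 (fun θ => (h θ : ℂ)),
        AddCircle.liftIco_continuous (by simp only [h0, h2])
          (Complex.continuous_ofReal.comp hh.continuous).continuousOn⟩
      have key := hzero H
      rw [hL', integral_circle] at key
      have hcongr : ∫ θ in (0 : ℝ)..(2 * π), H (θ : Circle2Pi) * g (θ : Circle2Pi) =
          ∫ θ in (0 : ℝ)..(2 * π), ((h θ * (f (θ : Circle2Pi) - c) : ℝ) : ℂ) := by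
        apply intervalIntegral.integral_congr_ae
        have : ∀ᵐ θ : ℝ, θ ≠ 2 * π := by simp [ae_iff]
        filter_upwards [this] with θ h1 h2
        rw [Set.uIoc_of_le two_pi_pos.le] at h2
        have h3 : θ ∈ Set.Ico (0 : ℝ) (0 + 2 * π) :=
          ⟨h2.1.le, by rw [zero_add]; exact lt_of_le_of_ne h2.2 h1⟩
        have : H (θ : Circle2Pi) = (h θ : ℂ) :=
          AddCircle.liftIco_coe_apply (f := fun θ => (h θ : ℂ)) h3
        rw [this]
        simp [hg]
      rw [hcongr, intervalIntegral.integral_ofReal] at key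
      have key' : ∫ θ in (0 : ℝ)..(2 * π), h θ * (f (θ : Circle2Pi) - c) = 0 := by
        exact_mod_cast key
      rw [← key', intervalIntegral.integral_of_le two_pi_pos.le]
      symm
      apply setIntegral_eq_integral_of_forall_compl_eq_zero
      intro θ hθ
      have : h θ = 0 := by
        by_contra hne
        have := hsupp (subset_tsupport _ hne)
        exact hθ ⟨this.1, this.2.le⟩
      simp [this]
  refine ae_coe_circle (p := fun x => f x = c) (ae_circle_of_ae_restrict ?_)
  rw [ae_restrict_iff' measurableSet_Ioc]
  have : ∀ᵐ θ : ℝ, θ ≠ 2 * π := by simp [ae_iff]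
  filter_upwards [hloc, this] with θ h1 h2 h3
  rw [zero_add] at h3
  linarith [h1 ⟨h3.1, lt_of_le_of_ne h3.2 h2⟩]

/-! ### The mean field drift and regularity of the states -/

/-- The drift `J ∗ u` of a density, written with its first Fourier moments. -/
noncomputable def drift (K : ℝ) (u : ℝ → ℝ) (θ : ℝ) : ℝ :=
  K * (sin θ * (∫ x in (0 : ℝ)..(2 * π), u x * cos x) -
    cos θ * ∫ x in (0 : ℝ)..(2 * π), u x * sin x)

/-- By the addition formula the sine kernel has rank two, so the nonlocal term sees the density only
through two moments. -/
theorem couplingConv_eq_drift {f : Circle2Pi → ℝ} (hf : Integrable f) (K θ : ℝ) :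
    couplingConv K f θ = drift K (fun x => f (x : Circle2Pi)) θ := by
  have hi := intervalIntegrable_coe_circle hf 0 (2 * π)
  unfold couplingConv drift
  rw [← intervalIntegral.integral_const_mul (sin θ), ← intervalIntegral.integral_const_mul (cos θ),
    ← intervalIntegral.integral_sub]
  · congr 1
    refine intervalIntegral.integral_congr fun x _ => ?_
    simp only [sin_sub]
    ring
  · exact (hi.mul_continuousOn (by fun_prop)).const_mul _
  · exact (hi.mul_continuousOn (by fun_prop)).const_mul _

theorem drift_congr_ae {u w : ℝ → ℝ} (h : ∀ᵐ x, u x = w x) (K θ : ℝ) :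
    drift K u θ = drift K w θ := by
  have h' : ∀ g : ℝ → ℝ, ∫ x in (0 : ℝ)..(2 * π), u x * g x = ∫ x in (0 : ℝ)..(2 * π), w x * g x :=
    fun g => intervalIntegral.integral_congr_ae (h.mono fun x hx _ => by rw [hx])
  unfold drift
  rw [h', h']

theorem continuous_drift (K : ℝ) (u : ℝ → ℝ) : Continuous (drift K u) := by
  unfold drift
  fun_prop

theorem periodic_drift (K : ℝ) (u : ℝ → ℝ) : Function.Periodic (drift K u) (2 * π) := fun x => by
  simp [drift]

/-- The drift exerts no total force. -/
theorem integral_mul_drift {u : ℝ → ℝ} (hu : IntervalIntegrable u volume 0 (2 * π)) (K : ℝ) :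
    ∫ θ in (0 : ℝ)..(2 * π), u θ * drift K u θ = 0 := by
  unfold drift
  generalize hx : (∫ x in (0 : ℝ)..(2 * π), u x * cos x) = a
  generalize hy : (∫ x in (0 : ℝ)..(2 * π), u x * sin x) = b
  have : ∀ θ, u θ * (K * (sin θ * a - cos θ * b)) = K * a * (u θ * sin θ) - K * b * (u θ * cos θ) :=
    fun θ => by ring
  simp only [this]
  rw [intervalIntegral.integral_sub, intervalIntegral.integral_const_mul,
    intervalIntegral.integral_const_mul, hx, hy]
  · ring
  · exact (hu.mul_continuousOn (by fun_prop)).const_mul _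
  · exact (hu.mul_continuousOn (by fun_prop)).const_mul _

/-- A continuous density `u` on the circle for which `u ^ m` is continuously differentiable, with
mean-zero flux `F = ∂_θ (u ^ m) + u (J ∗ u)`. -/
structure IsProfile (m K : ℝ) (u F : ℝ → ℝ) : Prop where
  cont : Continuous u
  periodic : Function.Periodic u (2 * π)
  nonneg : ∀ θ, 0 ≤ u θ
  mass : ∫ θ in (0 : ℝ)..(2 * π), u θ = 1
  cont_flux : Continuous F
  periodic_flux : Function.Periodic F (2 * π)
  mean_flux : ∫ θ in (0 : ℝ)..(2 * π), F θ = 0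
  hasDerivAt : ∀ θ, HasDerivAt (fun x => u x ^ m) (F θ - u θ * drift K u θ) θ

theorem isPeriodicTest_cos (n : ℕ) : IsPeriodicTest fun θ => cos (n * θ) :=
  ⟨by fun_prop, fun θ => by
    have := cos_add_nat_mul_two_pi (n * θ) n
    dsimp only
    rw [← this]; ring_nf⟩

theorem isPeriodicTest_sin (n : ℕ) : IsPeriodicTest fun θ => sin (n * θ) :=
  ⟨by fun_prop, fun θ => by
    have := sin_add_nat_mul_two_pi (n * θ) n
    dsimp only
    rw [← this]; ring_nf⟩

theorem isPeriodicTest_one : IsPeriodicTest fun _ => 1 := ⟨contDiff_const, fun _ => rfl⟩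

namespace IsPeriodicTest

variable {φ : ℝ → ℝ} (h : IsPeriodicTest φ)
include h

theorem hasDerivAt (x : ℝ) : HasDerivAt φ (deriv φ x) x :=
  (h.1.differentiable (by simp)).differentiableAt.hasDerivAt

protected theorem deriv : IsPeriodicTest (deriv φ) := by
  refine ⟨?_, fun x => ?_⟩
  · exact ((contDiff_succ_iff_deriv (n := ((⊤ : ℕ∞) : WithTop ℕ∞))).1
      (by simpa using h.1)).2.2
  · have h1 := h.hasDerivAt (x + 2 * π)
    have h2 := h1.comp_add_const x (2 * π)
    have h3 : (fun y => φ (y + 2 * π)) = φ := funext h.2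
    rw [h3] at h2
    exact h2.deriv.symm

theorem continuous : Continuous φ := h.1.continuous

end IsPeriodicTest

theorem hasDerivAt_cos_mul (n θ : ℝ) : HasDerivAt (fun θ => cos (n * θ)) (-n * sin (n * θ)) θ := by
  have := ((hasDerivAt_id θ).const_mul n).cos
  convert! this using 1
  simp only [id]
  ring

theorem hasDerivAt_sin_mul (n θ : ℝ) : HasDerivAt (fun θ => sin (n * θ)) (n * cos (n * θ)) θ := by
  have := ((hasDerivAt_id θ).const_mul n).sin
  convert! this using 1
  simp only [id]
  ring

theorem deriv_deriv_cos_mul (n θ : ℝ) :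
    deriv (deriv fun θ => cos (n * θ)) θ = -n ^ 2 * cos (n * θ) := by
  rw [funext fun θ => (hasDerivAt_cos_mul n θ).deriv,
    ((hasDerivAt_sin_mul n θ).const_mul (-n)).deriv]
  ring

theorem deriv_deriv_sin_mul (n θ : ℝ) :
    deriv (deriv fun θ => sin (n * θ)) θ = -n ^ 2 * sin (n * θ) := by
  rw [funext fun θ => (hasDerivAt_sin_mul n θ).deriv,
    ((hasDerivAt_cos_mul n θ).const_mul n).deriv]
  ring

/-- Regularity of the density in the stationary equation `v = ∂² (f ^ m) + ∂ (f (J ∗ f))`. -/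
theorem exists_profile {m K : ℝ} (hm : 1 < m) {f v : Circle2Pi → ℝ} (hf : Integrable f)
    (hv : Integrable v) (hfm : Integrable fun x => f x ^ m) (h0 : ∀ᵐ x, 0 ≤ f x)
    (h1 : ∫ x, f x = 1)
    (heq : ∀ φ : ℝ → ℝ, IsPeriodicTest φ → ∫ θ in (0 : ℝ)..(2 * π), v (θ : Circle2Pi) * φ θ =
      ∫ θ in (0 : ℝ)..(2 * π), ((f (θ : Circle2Pi)) ^ m * deriv (deriv φ) θ
            - f (θ : Circle2Pi) * couplingConv K f θ * deriv φ θ)) :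
    ∃ u, IsProfile m K u (normPrim fun θ => v (θ : Circle2Pi)) ∧
      ∀ᵐ θ : ℝ, f (θ : Circle2Pi) = u θ := by
  have hm0 : m ≠ 0 := by linarith
  have hfi := intervalIntegrable_coe_circle hf
  have hvi := intervalIntegrable_coe_circle hv
  have hfmi := intervalIntegrable_coe_circle hfm
  set fr : ℝ → ℝ := fun θ => f (θ : Circle2Pi) with hfr
  set vr : ℝ → ℝ := fun θ => v (θ : Circle2Pi) with hvr
  have hvmean : ∫ θ in (0 : ℝ)..(2 * π), vr θ = 0 := by
    simpa using heq _ isPeriodicTest_one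
  set F := normPrim vr with hF
  have hFc : Continuous F := continuous_normPrim hvi
  have hFp : Function.Periodic F (2 * π) := periodic_normPrim hvi (periodic_coe_circle v) hvmean
  have hF0 : ∫ θ in (0 : ℝ)..(2 * π), F θ = 0 := integral_normPrim hvi
  set I : ℝ → ℝ := fun θ => F θ - fr θ * drift K fr θ with hI
  have hfd : ∀ a b, IntervalIntegrable (fun θ => fr θ * drift K fr θ) volume a b := fun a b =>
    (hfi a b).mul_continuousOn (continuous_drift K fr).continuousOn
  have hIi : ∀ a b, IntervalIntegrable I volume a b := fun a b =>
    (hFc.intervalIntegrable a b).sub (hfd a b)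
  have hI0 : ∫ θ in (0 : ℝ)..(2 * π), I θ = 0 := by
    rw [hI, intervalIntegral.integral_sub (hFc.intervalIntegrable _ _) (hfd _ _), hF0,
      integral_mul_drift (hfi _ _)]
    simp
  have hIp : Function.Periodic I (2 * π) :=
    hFp.sub ((periodic_coe_circle f).mul (periodic_drift K fr))
  set H := normPrim I with hH
  have hHc : Continuous H := continuous_normPrim hIi
  have hHp : Function.Periodic H (2 * π) := periodic_normPrim hIi hIp hI0
  -- the function `f ^ m - H` on the circle
  have hHl : Continuous (hHp.lift) := by
    refine continuous_coinduced_dom.2 ?_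
    exact hHc
  set g : Circle2Pi → ℝ := fun x => f x ^ m - hHp.lift x with hg
  have hgi : Integrable g := hfm.sub (hHl.integrable_of_hasCompactSupport
    (HasCompactSupport.of_compactSpace _))
  -- One integration by parts turns `v` into `F`, another turns `I` into `H`; the weak equation then
  -- says that the second distributional derivative of `f ^ m - H` vanishes.
  have htest : ∀ φ, IsPeriodicTest φ →
      ∫ θ in (0 : ℝ)..(2 * π), g (θ : Circle2Pi) * deriv (deriv φ) θ = 0 := by
    intro φ hφ
    have hφ' := hφ.deriv
    have hφ'' := hφ'.deriv
    have e := heq φ hφ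
    have e1 : ∫ θ in (0 : ℝ)..(2 * π), vr θ * φ θ = -∫ θ in (0 : ℝ)..(2 * π), F θ * deriv φ θ :=
      integral_mul_eq_neg_of_periodic hvi hvmean hφ.hasDerivAt hφ'.continuous hφ.2
    have e2 : ∫ θ in (0 : ℝ)..(2 * π), I θ * deriv φ θ =
        -∫ θ in (0 : ℝ)..(2 * π), H θ * deriv (deriv φ) θ :=
      integral_mul_eq_neg_of_periodic hIi hI0 hφ'.hasDerivAt hφ''.continuous hφ'.2
    have i1 : IntervalIntegrable (fun θ => fr θ ^ m * deriv (deriv φ) θ) volume 0 (2 * π) :=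
      (hfmi 0 (2 * π)).mul_continuousOn hφ''.continuous.continuousOn
    have i2 : IntervalIntegrable (fun θ => fr θ * drift K fr θ * deriv φ θ) volume 0 (2 * π) :=
      (hfd 0 (2 * π)).mul_continuousOn hφ'.continuous.continuousOn
    have i3 : IntervalIntegrable (fun θ => F θ * deriv φ θ) volume 0 (2 * π) :=
      (hFc.mul hφ'.continuous).intervalIntegrable _ _
    have i4 : IntervalIntegrable (fun θ => H θ * deriv (deriv φ) θ) volume 0 (2 * π) :=
      (hHc.mul hφ''.continuous).intervalIntegrable _ _
    simp only [couplingConv_eq_drift hf] at e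
    rw [intervalIntegral.integral_sub i1 i2] at e
    simp only [hI, sub_mul] at e2
    rw [intervalIntegral.integral_sub i3 i2] at e2
    simp only [hg, sub_mul, Function.Periodic.lift_coe]
    rw [intervalIntegral.integral_sub i1 i4]
    linarith
  obtain ⟨c, hc⟩ := ae_eq_const_of_forall_integral_cos_sin hgi
    (fun n hn => by
      have h := htest _ (isPeriodicTest_cos n)
      have h' : ∀ θ : ℝ, g (θ : Circle2Pi) * (-(n : ℝ) ^ 2 * cos (n * θ)) =
        (-(n : ℝ) ^ 2) * (g (θ : Circle2Pi) * cos (n * θ)) := fun θ => by ring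
      simp only [deriv_deriv_cos_mul, h', intervalIntegral.integral_const_mul] at h
      simpa [hn] using h)
    (fun n hn => by
      have h := htest _ (isPeriodicTest_sin n)
      have h' : ∀ θ : ℝ, g (θ : Circle2Pi) * (-(n : ℝ) ^ 2 * sin (n * θ)) =
        (-(n : ℝ) ^ 2) * (g (θ : Circle2Pi) * sin (n * θ)) := fun θ => by ring
      simp only [deriv_deriv_sin_mul, h', intervalIntegral.integral_const_mul] at h
      simpa [hn] using h)
  set z : ℝ → ℝ := fun θ => H θ + c with hz
  have hzc : Continuous z := hHc.add continuous_const
  have hf0 := ae_coe_circle h0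
  have hfz : ∀ᵐ θ : ℝ, fr θ ^ m = z θ := by
    filter_upwards [hc] with θ hθ
    simp only [hg, Function.Periodic.lift_coe] at hθ
    simp only [hz, hfr]
    linarith
  -- Positivity is known only almost everywhere; `max z 0` and `z` are continuous and agree almost
  -- everywhere, hence everywhere.
  have hz0 : ∀ θ, 0 ≤ z θ := by
    have : (fun θ => max (z θ) 0) = z := by
      refine (Continuous.ae_eq_iff_eq (μ := volume) (by fun_prop) hzc).1 ?_
      filter_upwards [hfz, hf0] with θ h1 h2
      rw [← h1]
      exact max_eq_left (rpow_nonneg h2 _)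
    intro θ
    rw [← congrFun this θ]
    exact le_max_right _ _
  set u : ℝ → ℝ := fun θ => z θ ^ (m⁻¹) with hu
  have hfu : ∀ᵐ θ : ℝ, fr θ = u θ := by
    filter_upwards [hfz, hf0] with θ h1 h2
    simp only [hu]
    rw [← h1, rpow_rpow_inv h2 hm0]
  have huc : Continuous u := hzc.rpow_const fun θ => Or.inr (by positivity)
  have hum : (fun θ => u θ ^ m) = z := funext fun θ => rpow_inv_rpow (hz0 θ) hm0
  refine ⟨u, ⟨huc, ?_, fun θ => rpow_nonneg (hz0 θ) _, ?_, hFc, hFp, hF0, ?_⟩, hfu⟩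
  · intro θ
    simp only [hu, hz]
    rw [hHp θ]
  · rw [← h1, integral_circle]
    refine intervalIntegral.integral_congr_ae (hfu.mono fun x hx _ => hx.symm)
  · rw [hum]
    -- Bootstrap: `I` was only integrable, but with the continuous representative in place of `f`
    -- its primitive has a continuous integrand and is differentiable at every point.
    have hIu : ∀ᵐ θ : ℝ, I θ = F θ - u θ * drift K u θ := by
      filter_upwards [hfu] with θ hθ
      simp only [hI]
      rw [drift_congr_ae hfu, hθ]
    have : z = fun θ => normPrim (fun θ => F θ - u θ * drift K u θ) θ + c := by
      ext θ
      simp only [hz, hH]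
      rw [normPrim_congr_ae hIu]
    intro θ
    rw [this]
    exact (hasDerivAt_normPrim (hFc.sub (huc.mul (continuous_drift K u))) θ).add_const c

/-! ### Bounds for one profile and monotonicity for two -/

/-- Cauchy–Schwarz against the constant one, obtained from the nonnegativity of the variance of `g`.
-/
theorem sq_integral_le_mul_integral_sq {g : ℝ → ℝ} (hg : Continuous g) {a b : ℝ} (hab : a ≤ b) :
    (∫ x in a..b, g x) ^ 2 ≤ (b - a) * ∫ x in a..b, g x ^ 2 := by
  rcases hab.eq_or_lt with rfl | hlt
  · simp
  set c := (∫ x in a..b, g x) / (b - a) with hc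
  have h0 : 0 ≤ ∫ x in a..b, (g x - c) ^ 2 :=
    intervalIntegral.integral_nonneg hab fun x _ => sq_nonneg _
  have e : ∫ x in a..b, (g x - c) ^ 2 =
      (∫ x in a..b, g x ^ 2) - 2 * c * (∫ x in a..b, g x) + c ^ 2 * (b - a) := by
    have : ∀ x, (g x - c) ^ 2 = g x ^ 2 - 2 * c * g x + c ^ 2 := fun x => by ring
    simp only [this]
    rw [intervalIntegral.integral_add, intervalIntegral.integral_sub,
      intervalIntegral.integral_const_mul, intervalIntegral.integral_const]
    · simp; ring
    all_goals exact Continuous.intervalIntegrable (by fun_prop) _ _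
  have hne : b - a ≠ 0 := by linarith
  have hc' : c * (b - a) = ∫ x in a..b, g x := by rw [hc]; field_simp
  rw [e] at h0
  have : 0 ≤ (b - a) * ((∫ x in a..b, g x ^ 2) - 2 * c * (∫ x in a..b, g x) + c ^ 2 * (b - a)) :=
    mul_nonneg (by linarith) h0
  rw [← hc'] at this ⊢
  nlinarith

theorem sq_integral_abs_le {g : ℝ → ℝ} (hg : Continuous g) {a b : ℝ} (hab : a ≤ b) :
    (∫ x in a..b, |g x|) ^ 2 ≤ (b - a) * ∫ x in a..b, g x ^ 2 := by
  simpa using sq_integral_le_mul_integral_sq hg.abs hab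

theorem drift_eq_integral {u : ℝ → ℝ} (hu : Continuous u) (K θ : ℝ) :
    drift K u θ = K * ∫ x in (0 : ℝ)..(2 * π), u x * sin (θ - x) := by
  unfold drift
  rw [← intervalIntegral.integral_const_mul (sin θ), ← intervalIntegral.integral_const_mul (cos θ),
    ← intervalIntegral.integral_sub (Continuous.intervalIntegrable (by fun_prop) _ _)
      (Continuous.intervalIntegrable (by fun_prop) _ _)]
  congr 1
  refine intervalIntegral.integral_congr fun x _ => ?_
  simp only [sin_sub]
  ring

theorem hasDerivAt_drift {u : ℝ → ℝ} (hu : Continuous u) (K θ : ℝ) :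
    HasDerivAt (drift K u) (K * ∫ x in (0 : ℝ)..(2 * π), u x * cos (θ - x)) θ := by
  have h : HasDerivAt (drift K u) (K * (cos θ * (∫ x in (0 : ℝ)..(2 * π), u x * cos x) -
    (-sin θ) * ∫ x in (0 : ℝ)..(2 * π), u x * sin x)) θ :=
    (((hasDerivAt_sin θ).mul_const _).sub ((hasDerivAt_cos θ).mul_const _)).const_mul K
  convert! h using 2
  rw [← intervalIntegral.integral_const_mul (cos θ), ← intervalIntegral.integral_const_mul (-sin θ),
    ← intervalIntegral.integral_sub (Continuous.intervalIntegrable (by fun_prop) _ _)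
      (Continuous.intervalIntegrable (by fun_prop) _ _)]
  refine intervalIntegral.integral_congr fun x _ => ?_
  simp only [cos_sub]
  ring

theorem abs_integral_mul_le {u g : ℝ → ℝ} (hu : Continuous u) (hu0 : ∀ x, 0 ≤ u x)
    (hg : ∀ x, |g x| ≤ 1) {a b : ℝ} (hab : a ≤ b) :
    |∫ x in a..b, u x * g x| ≤ ∫ x in a..b, u x := by
  rw [← norm_eq_abs]
  refine intervalIntegral.norm_integral_le_of_norm_le (μ := volume) hab ?_
    (hu.intervalIntegrable _ _)
  filter_upwards with x _
  rw [norm_mul, norm_of_nonneg (hu0 x)]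
  exact mul_le_of_le_one_right (hu0 x) (hg x)

namespace IsProfile

variable {m K : ℝ} {u F : ℝ → ℝ}

theorem continuous_rpow (h : IsProfile m K u F) (hm : 1 < m) : Continuous fun x => u x ^ m :=
  h.cont.rpow_const fun _ => Or.inr (by linarith)

theorem continuous_deriv (h : IsProfile m K u F) :
    Continuous fun θ => F θ - u θ * drift K u θ :=
  h.cont_flux.sub (h.cont.mul (continuous_drift K u))

theorem abs_drift_le (h : IsProfile m K u F) (hK : 0 ≤ K) (θ : ℝ) : |drift K u θ| ≤ K := by
  rw [drift_eq_integral h.cont, abs_mul, abs_of_nonneg hK]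
  have := abs_integral_mul_le h.cont h.nonneg (g := fun x => sin (θ - x))
    (fun x => abs_sin_le_one _) two_pi_pos.le
  rw [h.mass] at this
  exact mul_le_of_le_one_right hK this

/-- The one-sided bound for the flux difference of two profiles in terms of the primitive of the
difference of the densities. -/
theorem integral_normPrim_mul_flux_sub_le {u₁ F₁ u₂ F₂ : ℝ → ℝ} {M : ℝ} (hm : 1 < m) (hK : 0 ≤ K)
    (h₁ : IsProfile m K u₁ F₁) (h₂ : IsProfile m K u₂ F₂) (hM : ∀ θ, u₂ θ ≤ M) :
    ∫ θ in (0 : ℝ)..(2 * π), normPrim (fun x => u₁ x - u₂ x) θ * (F₁ θ - F₂ θ) ≤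
      K * (1 / 2 + 2 * π * M) * ∫ θ in (0 : ℝ)..(2 * π), normPrim (fun x => u₁ x - u₂ x) θ ^ 2 := by
  set d : ℝ → ℝ := fun x => u₁ x - u₂ x with hd
  set e := normPrim d with he
  have c1 := h₁.cont
  have c2 := h₂.cont
  have f1 := h₁.cont_flux
  have f2 := h₂.cont_flux
  have hdc : Continuous d := c1.sub c2
  have hdi : ∀ a b, IntervalIntegrable d volume a b := hdc.intervalIntegrable
  have hec : Continuous e := continuous_normPrim hdi
  have hd0 : ∫ θ in (0 : ℝ)..(2 * π), d θ = 0 := by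
    rw [hd, intervalIntegral.integral_sub (c1.intervalIntegrable _ _) (c2.intervalIntegrable _ _),
      h₁.mass, h₂.mass, sub_self]
  have hep : Function.Periodic e (2 * π) :=
    periodic_normPrim hdi (h₁.periodic.sub h₂.periodic) hd0
  have hed : ∀ x, HasDerivAt e (d x) x := hasDerivAt_normPrim hdc
  have j1 := continuous_drift K u₁
  have j2 := continuous_drift K u₂
  -- the monotone part
  have hz : ∫ θ in (0 : ℝ)..(2 * π),
      ((F₁ θ - u₁ θ * drift K u₁ θ) - (F₂ θ - u₂ θ * drift K u₂ θ)) * e θ ≤ 0 := by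
    rw [integral_deriv_mul_of_periodic (fun x => (h₁.hasDerivAt x).sub (h₂.hasDerivAt x))
      (h₁.continuous_deriv.sub h₂.continuous_deriv) _ hed hdc hep]
    · rw [neg_nonpos]
      refine intervalIntegral.integral_nonneg two_pi_pos.le fun x _ => ?_
      simp only [Pi.sub_apply, hd]
      rcases le_total (u₁ x) (u₂ x) with hle | hle
      · have := rpow_le_rpow (h₁.nonneg x) hle (by linarith : 0 ≤ m)
        nlinarith
      · have := rpow_le_rpow (h₂.nonneg x) hle (by linarith : 0 ≤ m)
        nlinarith
    · intro x
      simp only [Pi.sub_apply, h₁.periodic x, h₂.periodic x]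
  -- the transport part
  have ht : ∫ θ in (0 : ℝ)..(2 * π), e θ * d θ * drift K u₁ θ ≤
      K * (1 / 2) * ∫ θ in (0 : ℝ)..(2 * π), e θ ^ 2 := by
    have hjc : Continuous fun θ => K * ∫ x in (0 : ℝ)..(2 * π), u₁ x * cos (θ - x) := by
      have : ∀ θ, ∫ x in (0 : ℝ)..(2 * π), u₁ x * cos (θ - x) =
          cos θ * (∫ x in (0 : ℝ)..(2 * π), u₁ x * cos x) +
            sin θ * ∫ x in (0 : ℝ)..(2 * π), u₁ x * sin x := by
        intro θ
        rw [← intervalIntegral.integral_const_mul (cos θ),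
          ← intervalIntegral.integral_const_mul (sin θ),
          ← intervalIntegral.integral_add (Continuous.intervalIntegrable (by fun_prop) _ _)
            (Continuous.intervalIntegrable (by fun_prop) _ _)]
        refine intervalIntegral.integral_congr fun x _ => ?_
        simp only [cos_sub]
        ring
      simp only [this]
      fun_prop
    have e2 : ∀ x, HasDerivAt (fun y => e y ^ 2 / 2) (e x * d x) x := fun x => by
      have := ((hed x).pow 2).div_const 2
      convert! this using 1
      simp
      ring
    -- Since `e * d` is the derivative of `e ^ 2 / 2`, the derivative moves to the drift, and that
    -- derivative is at least `-K` because `u₁` has mass one.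
    rw [integral_deriv_mul_of_periodic e2 (hec.mul hdc) (fun x => by simp only [hep x])
      (fun x => hasDerivAt_drift c1 K x) hjc (periodic_drift K u₁),
      ← intervalIntegral.integral_const_mul, ← intervalIntegral.integral_neg]
    refine intervalIntegral.integral_mono_on two_pi_pos.le
      (Continuous.intervalIntegrable (by fun_prop) _ _)
      (Continuous.intervalIntegrable (by fun_prop) _ _) fun θ _ => ?_
    have hb := abs_integral_mul_le c1 h₁.nonneg (g := fun x => cos (θ - x))
      (fun x => abs_cos_le_one _) two_pi_pos.le
    rw [h₁.mass] at hb
    have hb' := (abs_le.1 hb).1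
    have : 0 ≤ e θ ^ 2 / 2 * K * (1 + ∫ x in (0 : ℝ)..(2 * π), u₁ x * cos (θ - x)) :=
      mul_nonneg (by positivity) (by linarith)
    nlinarith
  -- the change of the drift
  have hj : ∀ θ, |drift K u₁ θ - drift K u₂ θ| ≤ K * ∫ x in (0 : ℝ)..(2 * π), |e x| := by
    intro θ
    have e1 : drift K u₁ θ - drift K u₂ θ = K * ∫ x in (0 : ℝ)..(2 * π), d x * sin (θ - x) := by
      rw [drift_eq_integral c1, drift_eq_integral c2, ← mul_sub, ← intervalIntegral.integral_sub
        (Continuous.intervalIntegrable (by fun_prop) _ _)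
        (Continuous.intervalIntegrable (by fun_prop) _ _)]
      congr 1
      refine intervalIntegral.integral_congr fun x _ => ?_
      simp only [hd]; ring
    have e2 : ∀ x, HasDerivAt (fun y => sin (θ - y)) (-cos (θ - x)) x := fun x => by
      have := ((hasDerivAt_id x).const_sub θ).sin
      convert! this using 1
      simp
    -- As `d` is the derivative of `e`, an integration by parts against the smooth kernel leaves
    -- only `e`, which is what the norm controls.
    rw [e1, integral_deriv_mul_of_periodic hed hdc hep e2 (by fun_prop)
      (fun x => by simp only [← sub_sub, sin_sub_two_pi]), abs_mul, abs_of_nonneg hK, abs_neg]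
    gcongr
    rw [← norm_eq_abs]
    refine intervalIntegral.norm_integral_le_of_norm_le (μ := volume) two_pi_pos.le ?_
      (hec.abs.intervalIntegrable _ _)
    filter_upwards with x _
    rw [norm_mul, norm_neg]
    exact mul_le_of_le_one_right (norm_nonneg _) (abs_cos_le_one _)
  have hM0 : 0 ≤ M := (h₂.nonneg 0).trans (hM 0)
  have hn : ∫ θ in (0 : ℝ)..(2 * π), e θ * ((drift K u₁ θ - drift K u₂ θ) * u₂ θ) ≤
      K * (2 * π * M) * ∫ θ in (0 : ℝ)..(2 * π), e θ ^ 2 := by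
    have hA0 : 0 ≤ ∫ x in (0 : ℝ)..(2 * π), |e x| :=
      intervalIntegral.integral_nonneg two_pi_pos.le fun x _ => abs_nonneg _
    calc ∫ θ in (0 : ℝ)..(2 * π), e θ * ((drift K u₁ θ - drift K u₂ θ) * u₂ θ)
        ≤ ∫ θ in (0 : ℝ)..(2 * π), |e θ| * ((K * ∫ x in (0 : ℝ)..(2 * π), |e x|) * M) := by
          refine intervalIntegral.integral_mono_on two_pi_pos.le
            (Continuous.intervalIntegrable (by fun_prop) _ _)
            (Continuous.intervalIntegrable (by fun_prop) _ _) fun θ _ => ?_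
          refine (le_abs_self _).trans ?_
          rw [abs_mul, abs_mul, abs_of_nonneg (h₂.nonneg θ)]
          have := h₂.nonneg θ
          gcongr
          · exact hj θ
          · exact hM θ
      _ = K * M * (∫ x in (0 : ℝ)..(2 * π), |e x|) ^ 2 := by
          rw [intervalIntegral.integral_mul_const]; ring
      _ ≤ K * M * ((2 * π - 0) * ∫ x in (0 : ℝ)..(2 * π), e x ^ 2) := by
          gcongr
          exact sq_integral_abs_le hec two_pi_pos.le
      _ = _ := by ring
  -- The transport terms are split asymmetrically: `u₁` times its drift minus `u₂` times its drift
  -- equals `d` times the drift of `u₁` plus `u₂` times the change of drift. Hence only `u₂` needs a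
  -- sup bound.
  have split : ∫ θ in (0 : ℝ)..(2 * π), e θ * (F₁ θ - F₂ θ) =
      (∫ θ in (0 : ℝ)..(2 * π),
        ((F₁ θ - u₁ θ * drift K u₁ θ) - (F₂ θ - u₂ θ * drift K u₂ θ)) * e θ) +
      (∫ θ in (0 : ℝ)..(2 * π), e θ * d θ * drift K u₁ θ) +
      ∫ θ in (0 : ℝ)..(2 * π), e θ * ((drift K u₁ θ - drift K u₂ θ) * u₂ θ) := by
    rw [← intervalIntegral.integral_add (Continuous.intervalIntegrable (by fun_prop) _ _)
        (Continuous.intervalIntegrable (by fun_prop) _ _),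
      ← intervalIntegral.integral_add (Continuous.intervalIntegrable (by fun_prop) _ _)
        (Continuous.intervalIntegrable (by fun_prop) _ _)]
    refine intervalIntegral.integral_congr fun x _ => ?_
    simp only [hd]; ring
  rw [split]
  linarith

/-- The fundamental theorem of calculus for `u ^ m`; it yields the sup bound, the equicontinuity and
the equation of the limit. -/
theorem rpow_sub_rpow (h : IsProfile m K u F) (a b : ℝ) :
    u b ^ m - u a ^ m = (∫ x in a..b, F x) - ∫ x in a..b, u x * drift K u x := by
  have hi : IntervalIntegrable (fun x => u x * drift K u x) volume a b :=
    (h.cont.mul (continuous_drift K u)).intervalIntegrable _ _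
  rw [← intervalIntegral.integral_eq_sub_of_hasDerivAt (fun x _ => h.hasDerivAt x)
    (h.continuous_deriv.intervalIntegrable _ _), intervalIntegral.integral_sub
    (h.cont_flux.intervalIntegrable _ _) hi]

/-- Cauchy–Schwarz. The interval is at most one period long, so its share of the square integral is
at most that of a full period. -/
theorem abs_integral_flux_le (h : IsProfile m K u F) {a b : ℝ} (hab : a ≤ b)
    (hb : b ≤ a + 2 * π) : |∫ x in a..b, F x| ≤
      √(b - a) * √(∫ x in (0 : ℝ)..(2 * π), F x ^ 2) := by
  rw [← sqrt_mul (by linarith)]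
  refine abs_le_sqrt ((sq_integral_le_mul_integral_sq h.cont_flux hab).trans ?_)
  refine mul_le_mul_of_nonneg_left ?_ (by linarith)
  have hp : Function.Periodic (fun x => F x ^ 2) (2 * π) := fun x => by
    simp only [h.periodic_flux x]
  have := hp.intervalIntegral_add_eq a 0
  rw [zero_add] at this
  rw [← this]
  refine intervalIntegral.integral_mono_interval le_rfl hab hb ?_
    ((h.cont_flux.pow 2).intervalIntegrable _ _)
  filter_upwards with x using sq_nonneg _

theorem integral_le_one (h : IsProfile m K u F) {a b : ℝ} (hab : a ≤ b)
    (hb : b ≤ a + 2 * π) : ∫ x in a..b, u x ≤ 1 := by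
  have := h.periodic.intervalIntegral_add_eq a 0
  rw [zero_add, h.mass] at this
  rw [← this]
  refine intervalIntegral.integral_mono_interval le_rfl hab hb ?_
    (h.cont.intervalIntegrable _ _)
  filter_upwards with x using h.nonneg x

theorem abs_integral_mul_drift_le (h : IsProfile m K u F) (hK : 0 ≤ K) {a b : ℝ} (hab : a ≤ b) :
    |∫ x in a..b, u x * drift K u x| ≤ K * ∫ x in a..b, u x := by
  rw [← intervalIntegral.integral_const_mul]
  rw [← norm_eq_abs]
  refine intervalIntegral.norm_integral_le_of_norm_le (μ := volume) hab ?_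
    ((continuous_const.mul h.cont).intervalIntegrable _ _)
  filter_upwards with x _
  rw [norm_mul, norm_of_nonneg (h.nonneg x), mul_comm]
  exact mul_le_mul_of_nonneg_right (h.abs_drift_le hK x) (h.nonneg x)

/-- The density is bounded in terms of the `L²` norm of the flux. -/
theorem le_bound (h : IsProfile m K u F) (hm : 1 < m) (hK : 0 ≤ K) (θ : ℝ) :
    u θ ≤ 1 + K + 3 * √(∫ x in (0 : ℝ)..(2 * π), F x ^ 2) := by
  set Φ := √(∫ x in (0 : ℝ)..(2 * π), F x ^ 2) with hΦ
  have hΦ0 : 0 ≤ Φ := sqrt_nonneg _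
  -- The mean of `u` is `1 / (2π) < 1`, so the density cannot exceed one everywhere.
  obtain ⟨a, ha⟩ : ∃ a, u a ≤ 1 := by
    by_contra! hcon
    have : ∫ x in (0 : ℝ)..(2 * π), (1 : ℝ) ≤ ∫ x in (0 : ℝ)..(2 * π), u x :=
      intervalIntegral.integral_mono_on two_pi_pos.le (by simp) (h.cont.intervalIntegrable _ _)
        fun x _ => (hcon x).le
    rw [h.mass] at this
    simp at this
    linarith [pi_gt_three]
  obtain ⟨b, ⟨hb1, hb2⟩, hb⟩ := h.periodic.exists_mem_Ico two_pi_pos θ a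
  rw [hb]
  have hab : a ≤ b := hb1
  have e := h.rpow_sub_rpow a b
  have e1 := h.abs_integral_flux_le hab hb2.le
  have e2 := (h.abs_integral_mul_drift_le hK hab).trans
    (mul_le_of_le_one_right hK (h.integral_le_one hab hb2.le))
  -- Source of the constant 3: the interval is shorter than `2π`, and `2π ≤ 9`.
  have e3 : √(b - a) ≤ 3 := by
    rw [sqrt_le_left (by norm_num)]
    linarith [pi_lt_four]
  have e4 : √(b - a) * Φ ≤ 3 * Φ := by gcongr
  have e5 : u a ^ m ≤ 1 := rpow_le_one (h.nonneg a) ha (by linarith)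
  have e6 : u b ^ m ≤ 1 + K + 3 * Φ := by
    have := (abs_le.1 e1).2
    have := (abs_le.1 e2).1
    linarith
  -- The bound for `u b ^ m` is also one for `u b`: a value above it would be at least one, and then
  -- `u b ≤ u b ^ m`.
  by_contra! hcon
  have h1 : 1 ≤ u b := by linarith
  have := self_le_rpow_of_one_le h1 hm.le
  linarith

/-- At a zero of `u` the function `u ^ m` attains its minimum, so its derivative vanishes, and the
transport part of the flux vanishes with `u`. This handles the degenerate points in the dissipation
identity. -/
theorem flux_eq_zero (h : IsProfile m K u F) (hm : 1 < m) {θ : ℝ} (hθ : u θ = 0) : F θ = 0 := by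
  have hmin : IsLocalMin (fun x => u x ^ m) θ := by
    refine Eventually.of_forall fun x => ?_
    simp only [hθ]
    rw [zero_rpow (by linarith)]
    exact rpow_nonneg (h.nonneg x) _
  have := hmin.hasDerivAt_eq_zero (h.hasDerivAt θ)
  simpa [hθ] using this

end IsProfile

/-! ### Regularized powers and energy dissipation -/

/-- Differentiating a regularization of `u ^ (m - 1)`, where only `u ^ m` is differentiable. -/
theorem hasDerivAt_regularized_rpow {m ε θ z' : ℝ} {u : ℝ → ℝ} (hm : 1 < m) (hε : 0 < ε)
    (h0 : 0 ≤ u θ) (h : HasDerivAt (fun x => u x ^ m) z' θ) :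
    HasDerivAt (fun x => (u x ^ m + ε) ^ ((m - 1) / m))
      ((m - 1) / m * ((u θ ^ m + ε) ^ (-m⁻¹) * z')) θ := by
  have hpos : 0 < u θ ^ m + ε := by positivity
  have := (h.add_const ε).rpow_const (p := (m - 1) / m) (Or.inl hpos.ne')
  convert! this using 1
  have hm0 : m ≠ 0 := by linarith
  have : (m - 1) / m - 1 = -m⁻¹ := by field_simp; ring
  rw [this]; ring

/-- This product is what the chain rule leaves in front of the drift; the bound dominates it
uniformly in the regularization. -/
theorem mul_rpow_regularized_le_one {m ε a : ℝ} (hm : 1 < m) (hε : 0 < ε) (ha : 0 ≤ a) :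
    a * (a ^ m + ε) ^ (-m⁻¹) ≤ 1 := by
  have hm0 : m ≠ 0 := by linarith
  have hpos : 0 < a ^ m + ε := by positivity
  rw [rpow_neg hpos.le, ← div_eq_mul_inv, div_le_one (by positivity)]
  calc a = (a ^ m) ^ m⁻¹ := (rpow_rpow_inv ha hm0).symm
    _ ≤ _ := by
      have : 0 ≤ m⁻¹ := by positivity
      gcongr
      linarith

/-- Positivity of `a` is essential: at `a = 0` the product is zero for every positive
regularization, so zeros of the density need a separate argument. -/
theorem tendsto_mul_rpow_regularized {m a : ℝ} (hm : 1 < m) (ha : 0 < a) {ε : ℕ → ℝ}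
    (hε : Tendsto ε atTop (𝓝 0)) :
    Tendsto (fun n => a * (a ^ m + ε n) ^ (-m⁻¹)) atTop (𝓝 1) := by
  have hm0 : m ≠ 0 := by linarith
  have hpos : 0 < a ^ m := by positivity
  have h1 : Tendsto (fun n => a ^ m + ε n) atTop (𝓝 (a ^ m)) := by
    simpa using hε.const_add (a ^ m)
  have h2 := (h1.rpow_const (p := -m⁻¹) (Or.inl hpos.ne')).const_mul a
  have : a * (a ^ m) ^ (-m⁻¹) = 1 := by
    rw [rpow_neg hpos.le, rpow_rpow_inv ha.le hm0, mul_inv_cancel₀ ha.ne']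
  rwa [this] at h2

theorem tendsto_regularized_rpow {m a : ℝ} (hm : 1 < m) (ha : 0 ≤ a) {ε : ℕ → ℝ}
    (hε : Tendsto ε atTop (𝓝 0)) :
    Tendsto (fun n => (a ^ m + ε n) ^ ((m - 1) / m)) atTop (𝓝 (a ^ (m - 1))) := by
  have hm0 : m ≠ 0 := by linarith
  have h1 : Tendsto (fun n => a ^ m + ε n) atTop (𝓝 (a ^ m)) := by
    simpa using hε.const_add (a ^ m)
  have h2 := h1.rpow_const (p := (m - 1) / m) (Or.inr (div_nonneg (by linarith) (by linarith)))
  have : (a ^ m) ^ ((m - 1) / m) = a ^ (m - 1) := by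
    rw [← rpow_mul ha]; congr 1; field_simp
  rwa [this] at h2

theorem continuous_regularized_rpow {m ε : ℝ} {u : ℝ → ℝ} (hm : 1 < m) (hε : 0 < ε)
    (hu : Continuous u) (h0 : ∀ x, 0 ≤ u x) (p : ℝ) : Continuous fun x => (u x ^ m + ε) ^ p := by
  refine ((hu.rpow_const fun _ => Or.inr (by linarith)).add continuous_const).rpow_const
    fun x => Or.inl ?_
  exact (add_pos_of_nonneg_of_pos (rpow_nonneg (h0 x) m) hε).ne'

theorem tendsto_intervalIntegral_of_bounded {f : ℕ → ℝ → ℝ} {g : ℝ → ℝ} {a b : ℝ} (B : ℝ → ℝ)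
    (hf : ∀ n, IntervalIntegrable (f n) volume a b)
    (hB : IntervalIntegrable B volume a b) (hb : ∀ n x, |f n x| ≤ B x)
    (h : ∀ x, Tendsto (fun n => f n x) atTop (𝓝 (g x))) :
    Tendsto (fun n => ∫ x in a..b, f n x) atTop (𝓝 (∫ x in a..b, g x)) :=
  intervalIntegral.tendsto_integral_filter_of_dominated_convergence B
    (Eventually.of_forall fun n => by
      rcases le_total a b with h | h
      · rw [Set.uIoc_of_le h]; exact (hf n).1.aestronglyMeasurable
      · rw [Set.uIoc_of_ge h]; exact (hf n).2.aestronglyMeasurable)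
    (Eventually.of_forall fun n => Eventually.of_forall fun x _ => hb n x) hB
    (Eventually.of_forall fun x _ => h x)

theorem regularized_rpow_le {m a R ε : ℝ} (hm : 1 < m) (ha : 0 ≤ a) (hR : a ≤ R) (hε : 0 < ε)
    (hε1 : ε ≤ 1) : |(a ^ m + ε) ^ ((m - 1) / m)| ≤ (R ^ m + 1) ^ ((m - 1) / m) := by
  have hpos : 0 ≤ a ^ m + ε := by positivity
  rw [abs_of_nonneg (rpow_nonneg hpos _)]
  refine rpow_le_rpow hpos ?_ (div_nonneg (by linarith) (by linarith))
  have := rpow_le_rpow ha hR (by linarith : 0 ≤ m)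
  linarith

namespace IsProfile

variable {m K : ℝ} {u F : ℝ → ℝ}

/-- Energy dissipation: the first variation of the free energy in the direction `v = ∂_θ F`. -/
theorem dissipation {v : ℝ → ℝ} {M : ℝ} (hm : 1 < m)
    (hv : ∀ a b, IntervalIntegrable v volume a b) (hv0 : ∫ θ in (0 : ℝ)..(2 * π), v θ = 0)
    (h : IsProfile m K u (normPrim v)) (hM0 : 0 < M) (hM : ∀ θ, u θ ≤ M) :
    m / (m - 1) * (∫ θ in (0 : ℝ)..(2 * π), v θ * u θ ^ (m - 1)) -
      K * ((∫ θ in (0 : ℝ)..(2 * π), u θ * cos θ) * (∫ θ in (0 : ℝ)..(2 * π), v θ * cos θ) +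
        (∫ θ in (0 : ℝ)..(2 * π), u θ * sin θ) * ∫ θ in (0 : ℝ)..(2 * π), v θ * sin θ) ≤
      -((∫ θ in (0 : ℝ)..(2 * π), normPrim v θ ^ 2) / M) := by
  set F := normPrim v with hF
  have hm0 : m ≠ 0 := by linarith
  have hm1 : m - 1 ≠ 0 := by linarith
  have uc := h.cont
  have Fc := h.cont_flux
  have jc := continuous_drift K u
  set ε : ℕ → ℝ := fun n => 1 / ((n : ℝ) + 1) with hε
  have hεpos : ∀ n, 0 < ε n := fun n => by positivity
  have hε1 : ∀ n, ε n ≤ 1 := fun n => by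
    rw [hε]; dsimp only
    rw [div_le_one (by positivity)]
    linarith [(Nat.cast_nonneg n : (0 : ℝ) ≤ n)]
  have hεlim : Tendsto ε atTop (𝓝 0) := tendsto_one_div_add_atTop_nhds_zero_nat
  have Xc : ∀ n, Continuous fun θ => (u θ ^ m + ε n) ^ (-m⁻¹) := fun n =>
    continuous_regularized_rpow hm (hεpos n) uc h.nonneg _
  -- the linear terms
  have hlin : K * ((∫ θ in (0 : ℝ)..(2 * π), u θ * cos θ) *
      (∫ θ in (0 : ℝ)..(2 * π), v θ * cos θ) +
        (∫ θ in (0 : ℝ)..(2 * π), u θ * sin θ) * ∫ θ in (0 : ℝ)..(2 * π), v θ * sin θ) =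
      ∫ θ in (0 : ℝ)..(2 * π), F θ * drift K u θ := by
    have e1 : ∫ θ in (0 : ℝ)..(2 * π), v θ * cos θ = ∫ θ in (0 : ℝ)..(2 * π), F θ * sin θ := by
      rw [integral_mul_eq_neg_of_periodic hv hv0 hasDerivAt_cos (by fun_prop) cos_periodic]
      simp [hF]
    have e2 : ∫ θ in (0 : ℝ)..(2 * π), v θ * sin θ = -∫ θ in (0 : ℝ)..(2 * π), F θ * cos θ := by
      rw [integral_mul_eq_neg_of_periodic hv hv0 hasDerivAt_sin (by fun_prop) sin_periodic]
    rw [e1, e2]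
    unfold drift
    generalize (∫ θ in (0 : ℝ)..(2 * π), u θ * cos θ) = A
    generalize (∫ θ in (0 : ℝ)..(2 * π), u θ * sin θ) = B
    have : ∀ θ, F θ * (K * (sin θ * A - cos θ * B)) =
        K * A * (F θ * sin θ) - K * B * (F θ * cos θ) := fun θ => by ring
    simp only [this]
    rw [intervalIntegral.integral_sub (Continuous.intervalIntegrable (by fun_prop) _ _)
      (Continuous.intervalIntegrable (by fun_prop) _ _), intervalIntegral.integral_const_mul,
      intervalIntegral.integral_const_mul]
    ring
  -- the regularized first variation
  have hreg : ∀ n, m / (m - 1) * (∫ θ in (0 : ℝ)..(2 * π), v θ * (u θ ^ m + ε n) ^ ((m - 1) / m)) =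
      -∫ θ in (0 : ℝ)..(2 * π), F θ * ((u θ ^ m + ε n) ^ (-m⁻¹) * (F θ - u θ * drift K u θ)) := by
    intro n
    rw [integral_mul_eq_neg_of_periodic hv hv0
      (fun x => hasDerivAt_regularized_rpow hm (hεpos n) (h.nonneg x) (h.hasDerivAt x))
      (continuous_const.mul ((Xc n).mul h.continuous_deriv))
      (fun x => by simp only [h.periodic x]), mul_neg, ← intervalIntegral.integral_const_mul]
    congr 1
    refine intervalIntegral.integral_congr fun θ _ => ?_
    simp only [← hF]
    field_simp
  -- With `X = (u ^ m + ε) ^ (-1/m)` and drift `D`, the left side is `-∫ X F²` minus the error `∫ F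
  -- D (1 - u X)`. The bound `u ≤ M` gives a lower bound for `X` whose limit is `1 / M`.
  have hle : ∀ n, m / (m - 1) *
        (∫ θ in (0 : ℝ)..(2 * π), v θ * (u θ ^ m + ε n) ^ ((m - 1) / m)) -
        (∫ θ in (0 : ℝ)..(2 * π), F θ * drift K u θ) ≤
      -((M ^ m + ε n) ^ (-m⁻¹) * ∫ θ in (0 : ℝ)..(2 * π), F θ ^ 2) -
        ∫ θ in (0 : ℝ)..(2 * π), F θ * drift K u θ * (1 - u θ * (u θ ^ m + ε n) ^ (-m⁻¹)) := by
    intro n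
    have Xn := Xc n
    rw [hreg n, ← intervalIntegral.integral_const_mul, ← intervalIntegral.integral_neg,
      ← intervalIntegral.integral_neg,
      ← intervalIntegral.integral_sub (Continuous.intervalIntegrable (by fun_prop) _ _)
        (Continuous.intervalIntegrable (by fun_prop) _ _),
      ← intervalIntegral.integral_sub (Continuous.intervalIntegrable (by fun_prop) _ _)
        (Continuous.intervalIntegrable (by fun_prop) _ _)]
    refine intervalIntegral.integral_mono_on two_pi_pos.le
      (Continuous.intervalIntegrable (by fun_prop) _ _)
      (Continuous.intervalIntegrable (by fun_prop) _ _) fun θ _ => ?_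
    have hX : (M ^ m + ε n) ^ (-m⁻¹) ≤ (u θ ^ m + ε n) ^ (-m⁻¹) := by
      have h1 := rpow_nonneg (h.nonneg θ) m
      have h2 := hεpos n
      refine rpow_le_rpow_of_nonpos (by positivity) ?_ (by simp; linarith)
      have := rpow_le_rpow (h.nonneg θ) (hM θ) (by linarith : 0 ≤ m)
      linarith
    have := mul_le_mul_of_nonneg_right hX (sq_nonneg (F θ))
    nlinarith
  -- passing to the limit
  have lim1 : Tendsto (fun n => ∫ θ in (0 : ℝ)..(2 * π), v θ * (u θ ^ m + ε n) ^ ((m - 1) / m))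
      atTop (𝓝 (∫ θ in (0 : ℝ)..(2 * π), v θ * u θ ^ (m - 1))) := by
    refine tendsto_intervalIntegral_of_bounded (fun θ => |v θ| * (M ^ m + 1) ^ ((m - 1) / m))
      (fun n => (hv _ _).mul_continuousOn
        (continuous_regularized_rpow hm (hεpos n) uc h.nonneg _).continuousOn)
      ((hv _ _).abs.mul_const _) (fun n x => ?_)
      (fun x => (tendsto_regularized_rpow hm (h.nonneg x) hεlim).const_mul _)
    rw [abs_mul]
    gcongr
    exact regularized_rpow_le hm (h.nonneg x) (hM x) (hεpos n) (hε1 n)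
  have lim2 : Tendsto (fun n => ∫ θ in (0 : ℝ)..(2 * π),
      F θ * drift K u θ * (1 - u θ * (u θ ^ m + ε n) ^ (-m⁻¹))) atTop (𝓝 0) := by
    suffices h' : Tendsto (fun n => ∫ θ in (0 : ℝ)..(2 * π),
        F θ * drift K u θ * (1 - u θ * (u θ ^ m + ε n) ^ (-m⁻¹))) atTop
        (𝓝 (∫ _ in (0 : ℝ)..(2 * π), (0 : ℝ))) by
      rwa [intervalIntegral.integral_zero] at h'
    refine tendsto_intervalIntegral_of_bounded (fun θ => |F θ * drift K u θ|)
      (fun n => ?_) ((Fc.mul jc).abs.intervalIntegrable _ _) (fun n x => ?_) (fun x => ?_)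
    · have Xn := Xc n
      exact Continuous.intervalIntegrable (by fun_prop) _ _
    · rw [abs_mul]
      refine mul_le_of_le_one_right (abs_nonneg _) ?_
      have h1 := mul_rpow_regularized_le_one hm (hεpos n) (h.nonneg x)
      have h2 : 0 ≤ u x * (u x ^ m + ε n) ^ (-m⁻¹) := by
        have := rpow_nonneg (h.nonneg x) m
        exact mul_nonneg (h.nonneg x) (rpow_nonneg (by linarith [hεpos n]) _)
      rw [abs_le]
      constructor <;> linarith
    -- Where `u` vanishes the factor `1 - u X` stays equal to one, but there the flux is zero.
    · rcases (h.nonneg x).eq_or_lt with h0 | h0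
      · simp [h.flux_eq_zero hm h0.symm]
      · have := ((tendsto_mul_rpow_regularized hm h0 hεlim).const_sub 1).const_mul
          (F x * drift K u x)
        simpa using this
  have lim3 : Tendsto (fun n => (M ^ m + ε n) ^ (-m⁻¹)) atTop (𝓝 M⁻¹) := by
    have := (tendsto_mul_rpow_regularized hm hM0 hεlim).const_mul M⁻¹
    simpa [← mul_assoc, inv_mul_cancel₀ hM0.ne'] using this
  have lhs := (lim1.const_mul (m / (m - 1))).sub_const (∫ θ in (0 : ℝ)..(2 * π), F θ * drift K u θ)
  have rhs := ((lim3.mul_const (∫ θ in (0 : ℝ)..(2 * π), F θ ^ 2)).neg).sub lim2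
  have := le_of_tendsto_of_tendsto' lhs rhs hle
  rw [hlin]
  refine this.trans_eq ?_
  rw [sub_zero, div_eq_inv_mul]

end IsProfile

/-- A continuous periodic density whose power `m` has derivative `-u x sin` has the weak derivative
of its power `m - 1` given by the equilibrium equation. -/
theorem integral_rpow_mul_deriv_of_stationary {m x : ℝ} {u φ : ℝ → ℝ} (hm : 1 < m)
    (hu : Continuous u) (hp : Function.Periodic u (2 * π)) (h0 : ∀ θ, 0 ≤ u θ)
    (hd : ∀ θ, HasDerivAt (fun y => u y ^ m) (-(u θ * (x * sin θ))) θ) (hφ : IsPeriodicTest φ) :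
    ∫ θ in (0 : ℝ)..(2 * π), u θ ^ (m - 1) * deriv φ θ =
      -∫ θ in (0 : ℝ)..(2 * π),
        (if 0 < u θ then -((m - 1) / m * (x * sin θ)) else 0) * φ θ := by
  obtain ⟨R, hR⟩ : ∃ R, ∀ θ, u θ ≤ R := by
    obtain ⟨R, hR⟩ := (isCompact_Icc (a := (0 : ℝ)) (b := 2 * π)).bddAbove_image hu.continuousOn
    refine ⟨R, fun θ => ?_⟩
    obtain ⟨b, hb, hb'⟩ := hp.exists_mem_Ico₀ two_pi_pos θ
    rw [hb']
    exact hR ⟨b, ⟨hb.1, hb.2.le⟩, rfl⟩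
  set ε : ℕ → ℝ := fun n => 1 / ((n : ℝ) + 1) with hε
  have hεpos : ∀ n, 0 < ε n := fun n => by positivity
  have hε1 : ∀ n, ε n ≤ 1 := fun n => by
    rw [hε]; dsimp only
    rw [div_le_one (by positivity)]
    linarith [(Nat.cast_nonneg n : (0 : ℝ) ≤ n)]
  have hεlim : Tendsto ε atTop (𝓝 0) := tendsto_one_div_add_atTop_nhds_zero_nat
  have φc := hφ.continuous
  have φc' := hφ.deriv.continuous
  have Xc : ∀ (n : ℕ) (p : ℝ), Continuous fun θ => (u θ ^ m + ε n) ^ p := fun n p =>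
    continuous_regularized_rpow hm (hεpos n) hu h0 p
  have hc : ∀ n, Continuous fun θ =>
      (m - 1) / m * ((u θ ^ m + ε n) ^ (-m⁻¹) * -(u θ * (x * sin θ))) := fun n =>
    continuous_const.mul ((Xc n _).mul (by fun_prop))
  have hreg : ∀ n, ∫ θ in (0 : ℝ)..(2 * π), (u θ ^ m + ε n) ^ ((m - 1) / m) * deriv φ θ =
      -∫ θ in (0 : ℝ)..(2 * π),
        (m - 1) / m * ((u θ ^ m + ε n) ^ (-m⁻¹) * -(u θ * (x * sin θ))) * φ θ := by
    intro n
    rw [integral_deriv_mul_of_periodic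
      (fun y => hasDerivAt_regularized_rpow hm (hεpos n) (h0 y) (hd y)) (hc n)
      (fun y => by simp only [hp y]) hφ.hasDerivAt φc' hφ.2, neg_neg]
  have lim1 : Tendsto (fun n =>
      ∫ θ in (0 : ℝ)..(2 * π), (u θ ^ m + ε n) ^ ((m - 1) / m) * deriv φ θ)
      atTop (𝓝 (∫ θ in (0 : ℝ)..(2 * π), u θ ^ (m - 1) * deriv φ θ)) := by
    refine tendsto_intervalIntegral_of_bounded
      (fun θ => (R ^ m + 1) ^ ((m - 1) / m) * |deriv φ θ|)
      (fun n => ((Xc n _).mul φc').intervalIntegrable _ _)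
      ((continuous_const.mul φc'.abs).intervalIntegrable _ _) (fun n y => ?_)
      (fun y => (tendsto_regularized_rpow hm (h0 y) hεlim).mul_const _)
    rw [abs_mul]
    gcongr
    exact regularized_rpow_le hm (h0 y) (hR y) (hεpos n) (hε1 n)
  have lim2 : Tendsto (fun n => ∫ θ in (0 : ℝ)..(2 * π),
        (m - 1) / m * ((u θ ^ m + ε n) ^ (-m⁻¹) * -(u θ * (x * sin θ))) * φ θ) atTop
      (𝓝 (∫ θ in (0 : ℝ)..(2 * π),
        (if 0 < u θ then -((m - 1) / m * (x * sin θ)) else 0) * φ θ)) := by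
    refine tendsto_intervalIntegral_of_bounded (fun θ => |(m - 1) / m * (x * sin θ) * φ θ|)
      (fun n => ((hc n).mul φc).intervalIntegrable _ _)
      (Continuous.intervalIntegrable (by fun_prop) _ _) (fun n y => ?_) (fun y => ?_)
    · have h1 := mul_rpow_regularized_le_one hm (hεpos n) (h0 y)
      have h2 : 0 ≤ u y * (u y ^ m + ε n) ^ (-m⁻¹) := by
        have := rpow_nonneg (h0 y) m
        exact mul_nonneg (h0 y) (rpow_nonneg (by linarith [hεpos n]) _)
      have e : (m - 1) / m * ((u y ^ m + ε n) ^ (-m⁻¹) * -(u y * (x * sin y))) * φ y =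
          ((m - 1) / m * (x * sin y) * φ y) * -(u y * (u y ^ m + ε n) ^ (-m⁻¹)) := by ring
      rw [e, abs_mul, abs_neg, abs_of_nonneg h2]
      exact mul_le_of_le_one_right (abs_nonneg _) h1
    -- On the zero set the regularized derivative is identically zero, which produces the `else`
    -- branch of the limit.
    · rcases (h0 y).eq_or_lt with hy | hy
      · simp [← hy]
      · have := (tendsto_mul_rpow_regularized hm hy hεlim).const_mul
          (-((m - 1) / m * (x * sin y)) * φ y)
        rw [if_pos hy, mul_one] at *
        refine this.congr fun n => ?_
        ring
  refine tendsto_nhds_unique lim1 ?_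
  simp only [hreg]
  exact lim2.neg

/-! ### Continuous functionals on `L^m` and the `H⁻¹` norm -/

section LpCircle

variable {m : ℝ}

theorem LmCircle.coe_add (f g : LmCircle m) :
    ∀ᵐ θ : ℝ, (f + g : LmCircle m) (θ : Circle2Pi) = f (θ : Circle2Pi) + g (θ : Circle2Pi) :=
  ae_coe_circle (p := fun x => (f + g : LmCircle m) x = f x + g x) (Lp.coeFn_add f g)

theorem LmCircle.coe_sub (f g : LmCircle m) :
    ∀ᵐ θ : ℝ, (f - g : LmCircle m) (θ : Circle2Pi) = f (θ : Circle2Pi) - g (θ : Circle2Pi) :=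
  ae_coe_circle (p := fun x => (f - g : LmCircle m) x = f x - g x) (Lp.coeFn_sub f g)

theorem LmCircle.coe_smul (c : ℝ) (f : LmCircle m) :
    ∀ᵐ θ : ℝ, (c • f : LmCircle m) (θ : Circle2Pi) = c * f (θ : Circle2Pi) :=
  ae_coe_circle (p := fun x => (c • f : LmCircle m) x = c * f x) (Lp.coeFn_smul c f)

variable [hm : Fact (1 < m)]

theorem LmCircle.integrable (f : LmCircle m) : Integrable f :=
  (Lp.memLp f).integrable (fact_one_le_ofReal m).out

theorem LmCircle.intervalIntegrable (f : LmCircle m) (a b : ℝ) :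
    IntervalIntegrable (fun θ : ℝ => f (θ : Circle2Pi)) volume a b :=
  intervalIntegrable_coe_circle (LmCircle.integrable f) a b

theorem toReal_ofReal_exponent : (ENNReal.ofReal m).toReal = m :=
  ENNReal.toReal_ofReal (by linarith [hm.out])

theorem exponent_ne_zero : ENNReal.ofReal m ≠ 0 := by
  simpa using (by linarith [hm.out] : 0 < m)

-- Hölder's inequality on a space of finite measure.
variable (m) in
theorem exists_integral_abs_le_norm : ∃ C, 0 ≤ C ∧ ∀ f : LmCircle m,
    ∫ θ in (0 : ℝ)..(2 * π), |f (θ : Circle2Pi)| ≤ C * ‖f‖ := by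
  set c := (volume : Measure Circle2Pi) Set.univ ^
    (1 / (1 : ENNReal).toReal - 1 / (ENNReal.ofReal m).toReal) with hc
  have hctop : c ≠ ⊤ := by
    refine ENNReal.rpow_ne_top_of_nonneg ?_ (measure_ne_top _ _)
    rw [toReal_ofReal_exponent]
    simp only [ENNReal.toReal_one, div_one, one_div, sub_nonneg]
    exact inv_le_one_of_one_le₀ hm.out.le
  refine ⟨c.toReal, ENNReal.toReal_nonneg, fun f => ?_⟩
  have h1 := eLpNorm_le_eLpNorm_mul_rpow_measure_univ (μ := (volume : Measure Circle2Pi))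
    (fact_one_le_ofReal m).out (Lp.aestronglyMeasurable f)
  have h2 : ∫ θ in (0 : ℝ)..(2 * π), |f (θ : Circle2Pi)| = (eLpNorm f 1 volume).toReal := by
    rw [← integral_circle fun x => |f x|, eLpNorm_one_eq_lintegral_enorm,
      ← integral_norm_eq_lintegral_enorm (Lp.aestronglyMeasurable f)]
    rfl
  rw [h2, Lp.norm_def, mul_comm c.toReal, ← ENNReal.toReal_mul]
  exact ENNReal.toReal_mono (ENNReal.mul_ne_top (Lp.eLpNorm_ne_top f) hctop) h1

/-- Integration against a continuous function, as a continuous functional on `L^m`. -/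
theorem exists_testCLM {g : ℝ → ℝ} (hg : Continuous g) : ∃ T : LmCircle m →L[ℝ] ℝ,
    ∀ f : LmCircle m, T f = ∫ θ in (0 : ℝ)..(2 * π), f (θ : Circle2Pi) * g θ := by
  obtain ⟨C, hC0, hC⟩ := exists_integral_abs_le_norm m
  obtain ⟨R, hR⟩ := (isCompact_Icc (a := (0 : ℝ)) (b := 2 * π)).bddAbove_image hg.abs.continuousOn
  have hR' : ∀ x ∈ Set.Icc (0 : ℝ) (2 * π), |g x| ≤ R := fun x hx => hR ⟨x, hx, rfl⟩
  have hi : ∀ f : LmCircle m,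
      IntervalIntegrable (fun θ : ℝ => f (θ : Circle2Pi) * g θ) volume 0 (2 * π) := fun f =>
    (LmCircle.intervalIntegrable f _ _).mul_continuousOn hg.continuousOn
  let L : LmCircle m →ₗ[ℝ] ℝ :=
    { toFun := fun f => ∫ θ in (0 : ℝ)..(2 * π), f (θ : Circle2Pi) * g θ
      map_add' := fun f h => by
        rw [← intervalIntegral.integral_add (hi f) (hi h)]
        refine intervalIntegral.integral_congr_ae ?_
        filter_upwards [LmCircle.coe_add f h] with x hx _
        rw [hx, add_mul]
      map_smul' := fun c f => by
        rw [RingHom.id_apply, smul_eq_mul, ← intervalIntegral.integral_const_mul]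
        refine intervalIntegral.integral_congr_ae ?_
        filter_upwards [LmCircle.coe_smul c f] with x hx _
        rw [hx, mul_assoc] }
  refine ⟨L.mkContinuous (R * C) fun f => ?_, fun f => rfl⟩
  have h1 : ‖L f‖ ≤ ∫ θ in (0 : ℝ)..(2 * π), R * |f (θ : Circle2Pi)| := by
    refine intervalIntegral.norm_integral_le_of_norm_le (μ := volume) two_pi_pos.le ?_
      ((LmCircle.intervalIntegrable f _ _).abs.const_mul R)
    filter_upwards with x hx
    rw [norm_mul, mul_comm]
    exact mul_le_mul_of_nonneg_right (hR' x ⟨hx.1.le, hx.2⟩) (norm_nonneg _)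
  rw [intervalIntegral.integral_const_mul] at h1
  have hR0 : 0 ≤ R := (abs_nonneg _).trans (hR' 0 ⟨le_rfl, two_pi_pos.le⟩)
  calc ‖L f‖ ≤ R * (C * ‖f‖) := h1.trans (mul_le_mul_of_nonneg_left (hC f) hR0)
    _ = R * C * ‖f‖ := by ring

theorem memLp_restrict_of_continuous {g : ℝ → ℝ} (hg : Continuous g) (p : ENNReal) :
    MemLp g p (volume.restrict (Set.Ioc 0 (2 * π))) := by
  obtain ⟨R, hR⟩ := (isCompact_Icc (a := (0 : ℝ)) (b := 2 * π)).bddAbove_image hg.abs.continuousOn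
  refine MemLp.of_bound hg.aestronglyMeasurable R ?_
  rw [ae_restrict_iff' measurableSet_Ioc]
  filter_upwards with x hx
  exact hR ⟨x, ⟨hx.1.le, hx.2⟩, rfl⟩

/-- The Hilbert space `L²(0, 2π)`. -/
abbrev L2Period : Type := Lp ℝ 2 (volume.restrict (Set.Ioc 0 (2 * π)))

theorem inner_toLp_toLp {f g : ℝ → ℝ} (hf : Continuous f) (hg : Continuous g) :
    inner ℝ ((memLp_restrict_of_continuous hf 2).toLp f : L2Period)
      ((memLp_restrict_of_continuous hg 2).toLp g) = ∫ θ in (0 : ℝ)..(2 * π), f θ * g θ := by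
  rw [L2.inner_def, intervalIntegral.integral_of_le two_pi_pos.le]
  refine integral_congr_ae ?_
  filter_upwards [(memLp_restrict_of_continuous hf 2).coeFn_toLp,
    (memLp_restrict_of_continuous hg 2).coeFn_toLp] with x h1 h2
  rw [h1, h2]
  simp [mul_comm]

/-- The mean-zero primitive of a function in `L^m`. -/
noncomputable def LmCircle.prim (f : LmCircle m) : ℝ → ℝ :=
  normPrim fun θ => f (θ : Circle2Pi)

theorem LmCircle.continuous_prim (f : LmCircle m) : Continuous (LmCircle.prim f) :=
  continuous_normPrim (LmCircle.intervalIntegrable f)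

theorem abs_normPrim_le {f : ℝ → ℝ} (hf : ∀ a b, IntervalIntegrable f volume a b) {θ : ℝ}
    (hθ : θ ∈ Set.Icc 0 (2 * π)) :
    |normPrim f θ| ≤ 2 * ∫ x in (0 : ℝ)..(2 * π), |f x| := by
  have h1 : ∀ y ∈ Set.Icc 0 (2 * π), |∫ x in (0 : ℝ)..y, f x| ≤ ∫ x in (0 : ℝ)..(2 * π), |f x| := by
    intro y hy
    refine (intervalIntegral.abs_integral_le_integral_abs hy.1).trans ?_
    refine intervalIntegral.integral_mono_interval le_rfl hy.1 hy.2 ?_ (hf _ _).abs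
    filter_upwards with x using abs_nonneg _
  set A := ∫ x in (0 : ℝ)..(2 * π), |f x| with hA
  have h2 : |∫ y in (0 : ℝ)..(2 * π), ∫ x in (0 : ℝ)..y, f x| ≤ A * |2 * π - 0| := by
    refine intervalIntegral.norm_integral_le_of_norm_le_const (a := 0) (b := 2 * π)
      (f := fun y => ∫ x in (0 : ℝ)..y, f x) fun y hy => ?_
    rw [Set.uIoc_of_le two_pi_pos.le] at hy
    exact h1 y ⟨hy.1.le, hy.2⟩
  rw [sub_zero, abs_of_pos two_pi_pos] at h2
  have h3 : |(2 * π)⁻¹ * ∫ y in (0 : ℝ)..(2 * π), ∫ x in (0 : ℝ)..y, f x| ≤ A := by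
    rw [abs_mul, abs_of_pos (inv_pos.2 two_pi_pos), inv_mul_le_iff₀ two_pi_pos, mul_comm (2 * π)]
    exact h2
  unfold normPrim
  have := abs_sub (∫ x in (0 : ℝ)..θ, f x)
    ((2 * π)⁻¹ * ∫ y in (0 : ℝ)..(2 * π), ∫ x in (0 : ℝ)..y, f x)
  linarith [h1 θ hθ]

-- The primitive is bounded by twice the `L¹` norm of `f`, hence by its `L^m` norm. For mean-zero
-- `f` its `L²` norm is the `H⁻¹` norm; realizing it through a bounded operator into a Hilbert space
-- lets that norm be differentiated along a curve.
variable (m) in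
theorem exists_primCLM : ∃ Q : LmCircle m →L[ℝ] L2Period, ∀ f : LmCircle m,
    Q f = (memLp_restrict_of_continuous (LmCircle.continuous_prim f) 2).toLp _ := by
  obtain ⟨C, hC0, hC⟩ := exists_integral_abs_le_norm m
  let L : LmCircle m →ₗ[ℝ] L2Period :=
    { toFun := fun f => (memLp_restrict_of_continuous (LmCircle.continuous_prim f) 2).toLp _
      map_add' := fun f h => by
        rw [← MemLp.toLp_add]
        refine MemLp.toLp_congr _ _ (Eventually.of_forall fun θ => ?_)
        change normPrim _ θ = normPrim _ θ + normPrim _ θ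
        rw [normPrim_congr_ae (LmCircle.coe_add f h) θ, normPrim_add
          (LmCircle.intervalIntegrable f) (LmCircle.intervalIntegrable h)]
      map_smul' := fun c f => by
        rw [RingHom.id_apply, ← MemLp.toLp_const_smul]
        refine MemLp.toLp_congr _ _ (Eventually.of_forall fun θ => ?_)
        change normPrim _ θ = c * normPrim _ θ
        rw [normPrim_congr_ae (LmCircle.coe_smul c f) θ, normPrim_const_mul] }
  set c : ℝ := (measureUnivNNReal (volume.restrict (Set.Ioc 0 (2 * π))) : ℝ) ^
    (2 : ENNReal).toReal⁻¹ with hc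
  refine ⟨L.mkContinuous (c * (2 * C)) fun f => ?_, fun f => rfl⟩
  have h1 : ‖L f‖ ≤ c * (2 * (C * ‖f‖)) := by
    refine Lp.norm_le_of_ae_bound (by positivity) ?_
    filter_upwards [(memLp_restrict_of_continuous (LmCircle.continuous_prim f) 2).coeFn_toLp,
      ae_restrict_mem measurableSet_Ioc] with θ h1 h2
    refine (congrArg norm h1).trans_le ?_
    exact (abs_normPrim_le (LmCircle.intervalIntegrable f) ⟨h2.1.le, h2.2⟩).trans (by
      have := hC f
      linarith)
  refine h1.trans_eq (by ring)

variable (m) in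
/-- `f ↦ (mean-zero primitive of f)` as a continuous linear map from `L^m` to `L²`. -/
noncomputable def primCLM : LmCircle m →L[ℝ] L2Period := (exists_primCLM m).choose

theorem primCLM_apply (f : LmCircle m) :
    primCLM m f = (memLp_restrict_of_continuous (LmCircle.continuous_prim f) 2).toLp _ :=
  (exists_primCLM m).choose_spec f

theorem inner_primCLM (f g : LmCircle m) : inner ℝ (primCLM m f) (primCLM m g) =
    ∫ θ in (0 : ℝ)..(2 * π), LmCircle.prim f θ * LmCircle.prim g θ := by
  rw [primCLM_apply, primCLM_apply,
    inner_toLp_toLp (LmCircle.continuous_prim f) (LmCircle.continuous_prim g)]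

theorem norm_sq_primCLM (f : LmCircle m) : ‖primCLM m f‖ ^ 2 =
    ∫ θ in (0 : ℝ)..(2 * π), LmCircle.prim f θ ^ 2 := by
  rw [← real_inner_self_eq_norm_sq, inner_primCLM]
  simp only [sq]

theorem norm_primCLM (f : LmCircle m) : ‖primCLM m f‖ =
    √(∫ θ in (0 : ℝ)..(2 * π), LmCircle.prim f θ ^ 2) := by
  rw [← norm_sq_primCLM, sqrt_sq (norm_nonneg _)]

theorem LmCircle.integrable_rpow (f : LmCircle m) (h0 : ∀ᵐ x, 0 ≤ f x) :
    Integrable fun x => f x ^ m := by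
  have := (Lp.memLp f).integrable_norm_rpow exponent_ne_zero ENNReal.ofReal_ne_top
  rw [toReal_ofReal_exponent] at this
  refine this.congr ?_
  filter_upwards [h0] with x hx
  rw [norm_of_nonneg hx]

/-- Multiplication by a continuous function on `L^m`. -/
theorem exists_mulCLM (g : C(Circle2Pi, ℝ)) : ∃ T : LmCircle m →L[ℝ] LmCircle m,
    ∀ f : LmCircle m, ∀ᵐ x, T f x = g x * f x := by
  have hmem : ∀ f : LmCircle m, MemLp (fun x => g x * f x) (ENNReal.ofReal m) volume := fun f =>
    (Lp.memLp f).of_le_mul (c := ‖g‖)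
      (g.continuous.aestronglyMeasurable.mul (Lp.aestronglyMeasurable f))
      (Eventually.of_forall fun x => by
        rw [norm_mul]
        exact mul_le_mul_of_nonneg_right (g.norm_coe_le_norm x) (norm_nonneg _))
  let L : LmCircle m →ₗ[ℝ] LmCircle m :=
    { toFun := fun f => (hmem f).toLp _
      map_add' := fun f h => by
        rw [← MemLp.toLp_add]
        refine MemLp.toLp_congr _ _ ?_
        filter_upwards [Lp.coeFn_add f h] with x hx
        rw [hx, Pi.add_apply, Pi.add_apply, mul_add]
      map_smul' := fun c f => by
        rw [RingHom.id_apply, ← MemLp.toLp_const_smul]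
        refine MemLp.toLp_congr _ _ ?_
        filter_upwards [Lp.coeFn_smul c f] with x hx
        rw [hx, Pi.smul_apply, Pi.smul_apply, smul_eq_mul, smul_eq_mul]
        ring }
  refine ⟨L.mkContinuous ‖g‖ fun f => ?_, fun f => (hmem f).coeFn_toLp⟩
  refine Lp.norm_le_mul_norm_of_ae_le_mul ?_
  filter_upwards [(hmem f).coeFn_toLp] with x hx
  refine (congrArg norm hx).trans_le ?_
  rw [norm_mul]
  exact mul_le_mul_of_nonneg_right (g.norm_coe_le_norm x) (norm_nonneg _)

theorem norm_rpow_eq_integral (f : LmCircle m) : ‖f‖ ^ m = ∫ x, |f x| ^ m := by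
  have hm0 : m ≠ 0 := by linarith [hm.out]
  have h0 : 0 ≤ ∫ x, |f x| ^ m := integral_nonneg fun x => rpow_nonneg (abs_nonneg _) _
  have h1 := (Lp.memLp f).eLpNorm_eq_integral_rpow_norm exponent_ne_zero ENNReal.ofReal_ne_top
  simp only [toReal_ofReal_exponent, norm_eq_abs] at h1
  rw [Lp.norm_def, h1, ENNReal.toReal_ofReal (rpow_nonneg h0 _), rpow_inv_rpow h0 hm0]

/-- For nonnegative `u`, the integral of `u ^ m * ψ` is `‖(ψ + ‖ψ‖)^(1/m) u‖ ^ m - ‖ψ‖ * ‖u‖ ^ m`,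
and norms are continuous. This avoids continuity of the map sending `u` to `u ^ m`. -/
theorem continuousOn_integral_rpow_mul {u : ℝ → LmCircle m} {s : Set ℝ} (hu : ContinuousOn u s)
    (h0 : ∀ t ∈ s, ∀ᵐ x, 0 ≤ u t x) (ψ : C(Circle2Pi, ℝ)) :
    ContinuousOn (fun t => ∫ x, u t x ^ m * ψ x) s := by
  have hm0 : 0 < m := by linarith [hm.out]
  have hψ : ∀ x, 0 ≤ ψ x + ‖ψ‖ := fun x => by
    have := (abs_le.1 (ψ.norm_coe_le_norm x)).1
    linarith
  have h1 : Continuous fun x => (ψ x + ‖ψ‖) ^ m⁻¹ :=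
    (ψ.continuous.add continuous_const).rpow_const fun x => Or.inr (by positivity)
  obtain ⟨T, hT⟩ := exists_mulCLM (m := m) ⟨_, h1⟩
  have key : ∀ t ∈ s, ‖T (u t)‖ ^ m - ‖ψ‖ * ‖u t‖ ^ m = ∫ x, u t x ^ m * ψ x := by
    intro t ht
    have hi := LmCircle.integrable_rpow (u t) (h0 t ht)
    have e1 : ‖T (u t)‖ ^ m = ∫ x, (u t x ^ m * ψ x + ‖ψ‖ * u t x ^ m) := by
      rw [norm_rpow_eq_integral]
      refine integral_congr_ae ?_
      filter_upwards [hT (u t), h0 t ht] with x hx hx0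
      rw [hx]
      simp only [ContinuousMap.coe_mk]
      rw [abs_of_nonneg (mul_nonneg (rpow_nonneg (hψ x) _) hx0),
        mul_rpow (rpow_nonneg (hψ x) _) hx0, rpow_inv_rpow (hψ x) hm0.ne']
      ring
    have e2 : ‖u t‖ ^ m = ∫ x, u t x ^ m := by
      rw [norm_rpow_eq_integral]
      refine integral_congr_ae ?_
      filter_upwards [h0 t ht] with x hx0
      rw [abs_of_nonneg hx0]
    rw [e1, e2, integral_add _ (hi.const_mul _), integral_const_mul]
    · ring
    · exact hi.mul_bdd (c := ‖ψ‖) ψ.continuous.aestronglyMeasurable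
        (Eventually.of_forall fun x => ψ.norm_coe_le_norm x)
  refine ContinuousOn.congr ?_ fun t ht => (key t ht).symm
  refine ContinuousOn.sub ?_ (continuousOn_const.mul ?_)
  · exact (T.continuous.comp_continuousOn hu).norm.rpow_const fun x _ => Or.inr hm0.le
  · exact hu.norm.rpow_const fun x _ => Or.inr hm0.le

end LpCircle

/-! ### Flows and their symmetries -/

theorem integral_comp_neg_of_periodic {g : ℝ → ℝ} (hg : Function.Periodic g (2 * π)) :
    ∫ θ in (0 : ℝ)..(2 * π), g (-θ) = ∫ θ in (0 : ℝ)..(2 * π), g θ := by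
  rw [intervalIntegral.integral_comp_neg]
  have := hg.intervalIntegral_add_eq (-(2 * π)) 0
  simpa using this

/-- A curve in `L^m` with velocity `v` whose states are densities solving the equation. -/
structure IsFlow (m K : ℝ) [Fact (1 < m)] (u v : ℝ → LmCircle m) : Prop where
  hasDerivWithinAt : ∀ t, 0 ≤ t → HasDerivWithinAt u (v t) (Set.Ici 0) t
  continuous_velocity : Continuous v
  exists_profile : ∀ t, 0 ≤ t → ∃ w, IsProfile m K w (LmCircle.prim (v t)) ∧
    ∀ᵐ θ : ℝ, u t (θ : Circle2Pi) = w θ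

/-- Reflection reverses derivatives and makes the drift change sign, so the flux is reflected and
negated. -/
theorem IsProfile.reflect {m K : ℝ} {u F : ℝ → ℝ} (h : IsProfile m K u F) :
    IsProfile m K (fun θ => u (-θ)) fun θ => -F (-θ) where
  cont := h.cont.comp continuous_neg
  periodic := fun x => by
    simp only [neg_add, ← sub_eq_add_neg, h.periodic.sub_eq]
  nonneg := fun θ => h.nonneg _
  mass := by rw [integral_comp_neg_of_periodic h.periodic, h.mass]
  cont_flux := (h.cont_flux.comp continuous_neg).neg
  periodic_flux := fun x => by
    simp only [neg_add, ← sub_eq_add_neg, h.periodic_flux.sub_eq]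
  mean_flux := by
    rw [intervalIntegral.integral_neg, integral_comp_neg_of_periodic h.periodic_flux, h.mean_flux,
      neg_zero]
  hasDerivAt := fun θ => by
    have h1 := (h.hasDerivAt (-θ)).scomp θ (hasDerivAt_neg θ)
    have e1 : ∫ x in (0 : ℝ)..(2 * π), u (-x) * cos x = ∫ x in (0 : ℝ)..(2 * π), u x * cos x := by
      rw [← integral_comp_neg_of_periodic (g := fun x => u x * cos x)
        (h.periodic.mul cos_periodic)]
      simp
    have e2 : ∫ x in (0 : ℝ)..(2 * π), u (-x) * sin x =
        -∫ x in (0 : ℝ)..(2 * π), u x * sin x := by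
      rw [← integral_comp_neg_of_periodic (g := fun x => u x * sin x)
        (h.periodic.mul sin_periodic), ← intervalIntegral.integral_neg]
      simp
    have e3 : drift K (fun θ => u (-θ)) θ = -drift K u (-θ) := by
      unfold drift
      rw [e1, e2, sin_neg, cos_neg]
      ring
    rw [e3]
    convert! h1 using 1
    simp
    ring

/-- The mean-zero primitive of the reflection of `f`. -/
theorem normPrim_comp_neg {f : ℝ → ℝ} (hf : ∀ a b, IntervalIntegrable f volume a b)
    (hp : Function.Periodic f (2 * π)) (h0 : ∫ θ in (0 : ℝ)..(2 * π), f θ = 0) :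
    normPrim (fun x => f (-x)) = fun θ => -normPrim f (-θ) := by
  have hf' : ∀ a b, IntervalIntegrable (fun x => f (-x)) volume a b := fun a b => by
    rw [IntervalIntegrable.iff_comp_neg]
    simpa using hf (-a) (-b)
  have hFc := continuous_normPrim hf
  have hd : ∀ θ, normPrim (fun x => f (-x)) θ =
      -normPrim f (-θ) + (normPrim (fun x => f (-x)) 0 + normPrim f 0) := by
    intro θ
    have e1 := normPrim_sub_normPrim hf' 0 θ
    have e2 := normPrim_sub_normPrim hf (-θ) 0
    rw [intervalIntegral.integral_comp_neg, neg_zero, ← e2] at e1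
    linarith
  set c := normPrim (fun x => f (-x)) 0 + normPrim f 0 with hc
  have i1 := integral_normPrim hf'
  have hcont : Continuous fun θ => -normPrim f (-θ) := (hFc.comp continuous_neg).neg
  simp only [hd] at i1
  rw [intervalIntegral.integral_add (hcont.intervalIntegrable _ _) (by simp),
    intervalIntegral.integral_neg,
    integral_comp_neg_of_periodic (periodic_normPrim hf hp h0), integral_normPrim hf] at i1
  have hc0 : c = 0 := by
    have := two_pi_pos.ne'
    simpa [this] using i1
  ext θ
  rw [hd, hc0, add_zero]

section

variable {m K : ℝ} [hm : Fact (1 < m)] {u v : ℝ → LmCircle m}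

namespace IsFlow

theorem continuousOn (h : IsFlow m K u v) : ContinuousOn u (Set.Ici 0) := fun t ht =>
  (h.hasDerivWithinAt t ht).continuousWithinAt

theorem integral_velocity (h : IsFlow m K u v) {t : ℝ} (ht : 0 ≤ t) :
    ∫ θ in (0 : ℝ)..(2 * π), v t (θ : Circle2Pi) = 0 := by
  obtain ⟨w, hw, -⟩ := h.exists_profile t ht
  have h1 := normPrim_sub_normPrim (LmCircle.intervalIntegrable (v t)) 0 (2 * π)
  have h2 := hw.periodic_flux 0
  rw [zero_add] at h2
  rw [← h1]
  simp only [LmCircle.prim] at h2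
  rw [h2, sub_self]

/-- The equation is autonomous. Comparing a flow with its own small shift turns stability into a
bound on the velocity. -/
theorem shift (h : IsFlow m K u v) {a : ℝ} (ha : 0 ≤ a) :
    IsFlow m K (fun t => u (t + a)) fun t => v (t + a) where
  hasDerivWithinAt := fun t ht => by
    have h1 := h.hasDerivWithinAt (t + a) (by linarith)
    have h2 := h1.scomp t ((hasDerivAt_id t).add_const a).hasDerivWithinAt
      (s := Set.Ici 0) (fun x hx => by
        have : (0 : ℝ) ≤ x := hx
        simp only [id, Set.mem_Ici]
        linarith)
    rw [one_smul] at h2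
    exact h2
  continuous_velocity := h.continuous_velocity.comp (continuous_add_const a)
  exists_profile := fun t ht => h.exists_profile (t + a) (by linarith)

/-- The reflection `f ↦ f (-·)` on `L^m`. -/
noncomputable def _root_.LmCircle.reflection : LmCircle m →ₗᵢ[ℝ] LmCircle m :=
  Lp.compMeasurePreservingₗᵢ ℝ (fun x : Circle2Pi => -x) (Measure.measurePreserving_neg volume)

theorem _root_.LmCircle.coe_reflection (f : LmCircle m) :
    ∀ᵐ x, LmCircle.reflection f x = f (-x) :=
  Lp.coeFn_compMeasurePreserving f (Measure.measurePreserving_neg volume)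

theorem _root_.LmCircle.coe_reflection_real (f : LmCircle m) :
    ∀ᵐ θ : ℝ, LmCircle.reflection f (θ : Circle2Pi) = f ((-θ : ℝ) : Circle2Pi) :=
  ae_coe_circle (p := fun x => LmCircle.reflection f x = f (-x)) (LmCircle.coe_reflection f)

/-- Comparison of a flow with its mirror image will show that evenness is preserved. -/
theorem reflect (h : IsFlow m K u v) :
    IsFlow m K (fun t => LmCircle.reflection (u t)) fun t => LmCircle.reflection (v t) where
  hasDerivWithinAt := fun t ht =>
    (LmCircle.reflection (m := m)).toContinuousLinearMap.hasFDerivAt.comp_hasDerivWithinAt t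
      (h.hasDerivWithinAt t ht)
  continuous_velocity := LmCircle.reflection.continuous.comp h.continuous_velocity
  exists_profile := fun t ht => by
    obtain ⟨w, hw, hwu⟩ := h.exists_profile t ht
    refine ⟨fun θ => w (-θ), ?_, ?_⟩
    · have e : LmCircle.prim (LmCircle.reflection (v t)) = fun θ => -LmCircle.prim (v t) (-θ) := by
        unfold LmCircle.prim
        rw [← normPrim_comp_neg (LmCircle.intervalIntegrable (v t)) (periodic_coe_circle _)
          (h.integral_velocity ht)]
        ext θ
        exact normPrim_congr_ae (LmCircle.coe_reflection_real (v t)) θ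
      rw [e]
      exact hw.reflect
    · have h1 : ∀ᵐ θ : ℝ, u t ((-θ : ℝ) : Circle2Pi) = w (-θ) :=
        (Measure.measurePreserving_neg (volume : Measure ℝ)).quasiMeasurePreserving.ae hwu
      filter_upwards [h1, LmCircle.coe_reflection_real (u t)] with θ h2 h3
      rw [h3, h2]

end IsFlow

/-- Continuously differentiable weak solutions solve the equation at every time. -/
theorem IsWeakSolution.exists_isFlow (hC1 : ContDiffOn ℝ 1 u (Set.Ici 0))
    (hsol : IsWeakSolution m K u) (hnonneg : ∀ t : ℝ, 0 ≤ t → ∀ᵐ θ, 0 ≤ u t θ)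
    (hmass : ∀ t : ℝ, 0 ≤ t → ∫ θ, u t θ = 1) : ∃ v, IsFlow m K u v := by
  have huc : ContinuousOn u (Set.Ici 0) := hC1.continuousOn
  have hvc := hC1.continuousOn_derivWithin (uniqueDiffOn_Ici 0) le_rfl
  have hmax : ∀ t : ℝ, max t 0 ∈ Set.Ici (0 : ℝ) := fun t => Set.mem_Ici.2 (le_max_right _ _)
  have hmaxc : Continuous fun t : ℝ => max t 0 := by fun_prop
  -- Freezing the velocity at negative times makes it continuous on the whole line.
  refine ⟨fun t => derivWithin u (Set.Ici 0) (max t 0), ?_⟩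
  have hd : ∀ t, 0 ≤ t → HasDerivWithinAt u (derivWithin u (Set.Ici 0) (max t 0)) (Set.Ici 0) t := by
    intro t ht
    rw [max_eq_left ht]
    exact (hC1.differentiableOn (by simp) t ht).hasDerivWithinAt
  refine ⟨hd, hvc.comp_continuous hmaxc hmax, fun t ht => ?_⟩
  refine _root_.exists_profile hm.out (LmCircle.integrable _) (LmCircle.integrable _)
    (LmCircle.integrable_rpow _ (hnonneg t ht)) (hnonneg t ht) (hmass t ht) fun φ hφ => ?_
  have φc := hφ.continuous
  have φc' := hφ.deriv.continuous
  have φc'' := hφ.deriv.deriv.continuous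
  obtain ⟨T, hT⟩ := exists_testCLM (m := m) φc
  obtain ⟨Tc, hTc⟩ := exists_testCLM (m := m) (g := fun θ => cos θ) (by fun_prop)
  obtain ⟨Ts, hTs⟩ := exists_testCLM (m := m) (g := fun θ => sin θ) (by fun_prop)
  obtain ⟨Tc', hTc'⟩ := exists_testCLM (m := m) (g := fun θ => cos θ * deriv φ θ) (by fun_prop)
  obtain ⟨Ts', hTs'⟩ := exists_testCLM (m := m) (g := fun θ => sin θ * deriv φ θ) (by fun_prop)
  set G : ℝ → ℝ := fun s => ∫ θ in (0 : ℝ)..(2 * π),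
    ((u s (θ : Circle2Pi)) ^ m * deriv (deriv φ) θ
      - u s (θ : Circle2Pi) * couplingConv K (u s) θ * deriv φ θ) with hG
  have hlift : Continuous hφ.deriv.deriv.2.lift := continuous_coinduced_dom.2 φc''
  -- The integrand in time is a weighted integral of `u ^ m` minus products of linear functionals,
  -- since the coupling has rank two. It is thus continuous, and the time-integrated equation can be
  -- differentiated at each time.
  have hGe : ∀ s ∈ Set.Ici (0 : ℝ), (∫ x, u s x ^ m * hφ.deriv.deriv.2.lift x) -
      K * (Tc (u s) * Ts' (u s) - Ts (u s) * Tc' (u s)) = G s := by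
    intro s hs
    have i0 := LmCircle.intervalIntegrable (u s) 0 (2 * π)
    have i1 := intervalIntegrable_coe_circle (LmCircle.integrable_rpow _ (hnonneg s hs)) 0 (2 * π)
    rw [hG, hTc, hTs, hTc', hTs', integral_circle]
    simp only [couplingConv_eq_drift (LmCircle.integrable (u s)), Function.Periodic.lift_coe]
    rw [intervalIntegral.integral_sub (i1.mul_continuousOn φc''.continuousOn)
      ((i0.mul_continuousOn (continuous_drift _ _).continuousOn).mul_continuousOn φc'.continuousOn)]
    congr 1
    unfold drift
    generalize (∫ θ in (0 : ℝ)..(2 * π), u s (θ : Circle2Pi) * cos θ) = A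
    generalize (∫ θ in (0 : ℝ)..(2 * π), u s (θ : Circle2Pi) * sin θ) = B
    rw [mul_sub, ← mul_assoc, ← mul_assoc, ← intervalIntegral.integral_const_mul,
      ← intervalIntegral.integral_const_mul, ← intervalIntegral.integral_sub
      ((i0.mul_continuousOn (by fun_prop)).const_mul _)
      ((i0.mul_continuousOn (by fun_prop)).const_mul _)]
    refine intervalIntegral.integral_congr fun θ _ => ?_
    ring
  have hGc : ContinuousOn G (Set.Ici 0) := by
    refine ContinuousOn.congr ?_ fun s hs => (hGe s hs).symm
    refine ContinuousOn.sub
      (continuousOn_integral_rpow_mul huc (fun s hs => hnonneg s hs) ⟨_, hlift⟩) ?_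
    exact continuousOn_const.mul (((Tc.continuous.comp_continuousOn huc).mul
      (Ts'.continuous.comp_continuousOn huc)).sub ((Ts.continuous.comp_continuousOn huc).mul
      (Tc'.continuous.comp_continuousOn huc)))
  have hGm : Continuous fun s => G (max s 0) := hGc.comp_continuous hmaxc hmax
  have h1 : HasDerivWithinAt (fun s => T (u s))
      (T (derivWithin u (Set.Ici 0) (max t 0))) (Set.Ici 0) t :=
    T.hasFDerivAt.comp_hasDerivWithinAt t (hd t ht)
  have h2 : HasDerivWithinAt (fun s => T (u s)) (G t) (Set.Ici 0) t := by
    have h3 : HasDerivAt (fun s => T (u 0) + ∫ τ in (0 : ℝ)..s, G (max τ 0)) (G (max t 0)) t :=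
      (intervalIntegral.integral_hasDerivAt_right (hGm.intervalIntegrable _ _)
        hGm.stronglyMeasurable.stronglyMeasurableAtFilter hGm.continuousAt).const_add _
    rw [max_eq_left ht] at h3
    have hcongr : ∀ s, 0 ≤ s → T (u s) = T (u 0) + ∫ τ in (0 : ℝ)..s, G (max τ 0) := by
      intro s hs
      rw [hT, hT, hsol φ hφ s hs]
      congr 1
      refine intervalIntegral.integral_congr fun τ hτ => ?_
      rw [Set.uIcc_of_le hs] at hτ
      simp only [hG, max_eq_left hτ.1]
    exact h3.hasDerivWithinAt.congr (fun s hs => hcongr s hs) (hcongr t ht)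
  have h3 := (uniqueDiffOn_Ici (0 : ℝ) t ht).eq_deriv _ h1 h2
  rw [← hT, h3]

end

/-! ### Differential inequalities in time -/

/-- A continuous function that is touched from below at every point by a differentiable function
with nonpositive derivative does not increase. -/
theorem le_of_touching_from_below {E : ℝ → ℝ} {a b : ℝ} (hab : a ≤ b)
    (hE : ContinuousOn E (Set.Icc a b))
    (h : ∀ t ∈ Set.Ioc a b, ∃ L : ℝ → ℝ, ∃ l : ℝ, (∀ s ∈ Set.Icc a b, L s ≤ E s) ∧ L t = E t ∧
      HasDerivAt L l t ∧ l ≤ 0) : E b ≤ E a := by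
  -- Touching from below bounds the slopes of `E` to the left of `t` from above. The mean value
  -- inequality used here needs right slopes, hence the reversal of time.
  have hc : ContinuousOn (fun x => -E (-x)) (Set.Icc (-b) (-a)) := by
    refine (hE.comp continuous_neg.continuousOn fun x hx => ?_).neg
    exact ⟨by linarith [hx.2], by linarith [hx.1]⟩
  have key := image_le_of_liminf_slope_right_le_deriv_boundary hc (B := fun _ => -E b)
    (B' := fun _ => 0) (by simp) continuousOn_const
    (fun x _ => hasDerivWithinAt_const _ _ _) (fun x hx r hr => ?_)
    (Set.right_mem_Icc.2 (neg_le_neg hab))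
  · simpa using key
  · obtain ⟨L, l, h1, h2, h3, h4⟩ := h (-x) ⟨by linarith [hx.2], by linarith [hx.1]⟩
    have h5 : HasDerivAt (fun z => -L (-z)) l x := by
      have := (h3.scomp x (hasDerivAt_neg x)).neg
      convert! this using 1
      simp
    have h6 := h5.hasDerivWithinAt (s := Set.Ioi x)
    rw [hasDerivWithinAt_iff_tendsto_slope' (by simp)] at h6
    have h7 := h6.eventually_lt_const (show l < r by linarith)
    have h8 : ∀ᶠ z in 𝓝[>] x, z ∈ Set.Ioo x (-a) := Ioo_mem_nhdsGT hx.2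
    refine (h7.and h8).frequently.mono fun z hz => lt_of_le_of_lt ?_ hz.1
    have h9 := h1 (-z) ⟨by linarith [hz.2.2], by linarith [hz.2.1, hx.1]⟩
    simp only [slope_def_field, h2]
    have : 0 ≤ z - x := by linarith [hz.2.1]
    gcongr

theorem hasDerivAt_integral_of_continuous {a : ℝ → ℝ} (ha : Continuous a) (s t : ℝ) :
    HasDerivAt (fun r => ∫ τ in s..r, a τ) (a t) t :=
  intervalIntegral.integral_hasDerivAt_right (ha.intervalIntegrable _ _)
    ha.stronglyMeasurable.stronglyMeasurableAtFilter ha.continuousAt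

/-- Grönwall's inequality with a time-dependent rate. -/
theorem le_exp_integral_mul_of_deriv_le {y y' a : ℝ → ℝ} (ha : Continuous a)
    (hy : ∀ t, 0 ≤ t → HasDerivWithinAt y (y' t) (Set.Ici 0) t)
    (hle : ∀ t, 0 ≤ t → y' t ≤ a t * y t) {s t : ℝ} (hs : 0 ≤ s) (hst : s ≤ t) :
    y t ≤ exp (∫ τ in s..t, a τ) * y s := by
  set A : ℝ → ℝ := fun r => ∫ τ in s..r, a τ with hA
  have hA' : ∀ r, HasDerivAt A (a r) r := hasDerivAt_integral_of_continuous ha s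
  have hd : ∀ r, 0 ≤ r → HasDerivWithinAt (fun r => y r * exp (-A r))
      (y' r * exp (-A r) + y r * (exp (-A r) * -a r)) (Set.Ici 0) r := fun r hr =>
    (hy r hr).mul (hA' r).neg.exp.hasDerivWithinAt
  have hanti : AntitoneOn (fun r => y r * exp (-A r)) (Set.Ici 0) := by
    refine antitoneOn_of_deriv_nonpos (convex_Ici 0)
      (fun r hr => (hd r hr).continuousWithinAt) (fun r hr => ?_) (fun r hr => ?_)
    all_goals
      rw [interior_Ici] at hr
      have hr' := (hd r (le_of_lt hr)).hasDerivAt (Ici_mem_nhds hr)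
    · exact hr'.differentiableAt.differentiableWithinAt
    · rw [hr'.deriv]
      have := hle r (le_of_lt hr)
      have h1 := exp_pos (-A r)
      nlinarith
  have := hanti (Set.mem_Ici.2 hs) (Set.mem_Ici.2 (hs.trans hst)) hst
  have hAs : A s = 0 := by simp [hA]
  simp only [hAs, neg_zero, exp_zero, mul_one] at this
  have h2 := mul_le_mul_of_nonneg_right this (exp_pos (A t)).le
  rw [mul_assoc, ← exp_add, neg_add_cancel, exp_zero, mul_one] at h2
  linarith

/-! ### Stability in `H⁻¹`: evenness and growth of the flux -/

namespace IsFlow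

variable {m K : ℝ} [hm : Fact (1 < m)] {u v u₁ v₁ u₂ v₂ : ℝ → LmCircle m}

/-- Stability of the flow in the `H⁻¹` norm. -/
theorem norm_sq_primCLM_sub_le (hK : 0 ≤ K) (h₁ : IsFlow m K u₁ v₁) (h₂ : IsFlow m K u₂ v₂)
    {s t : ℝ} (hs : 0 ≤ s) (hst : s ≤ t) :
    ‖primCLM m (u₁ t - u₂ t)‖ ^ 2 ≤
      exp (∫ τ in s..t, K * (1 + 4 * π * (1 + K + 3 * ‖primCLM m (v₂ τ)‖))) *
        ‖primCLM m (u₁ s - u₂ s)‖ ^ 2 := by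
  set Q := primCLM m with hQ
  have ha : Continuous fun τ => K * (1 + 4 * π * (1 + K + 3 * ‖Q (v₂ τ)‖)) := by
    have := h₂.continuous_velocity
    fun_prop
  refine le_exp_integral_mul_of_deriv_le (y := fun t => ‖Q (u₁ t - u₂ t)‖ ^ 2)
    (y' := fun t => 2 * inner ℝ (Q (u₁ t - u₂ t)) (Q (v₁ t - v₂ t))) ha (fun t ht => ?_)
    (fun t ht => ?_) hs hst
  · exact (Q.hasFDerivAt.comp_hasDerivWithinAt t
      ((h₁.hasDerivWithinAt t ht).sub (h₂.hasDerivWithinAt t ht))).norm_sq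
  · obtain ⟨w₁, p₁, e₁⟩ := h₁.exists_profile t ht
    obtain ⟨w₂, p₂, e₂⟩ := h₂.exists_profile t ht
    have hb := IsProfile.integral_normPrim_mul_flux_sub_le hm.out hK p₁ p₂
      (p₂.le_bound hm.out hK)
    have e3 : LmCircle.prim (u₁ t - u₂ t) = normPrim fun x => w₁ x - w₂ x := by
      ext θ
      refine normPrim_congr_ae ?_ θ
      filter_upwards [LmCircle.coe_sub (u₁ t) (u₂ t), e₁, e₂] with x h1 h2 h3
      rw [h1, h2, h3]
    have e4 : LmCircle.prim (v₁ t - v₂ t) =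
        fun θ => LmCircle.prim (v₁ t) θ - LmCircle.prim (v₂ t) θ := by
      ext θ
      unfold LmCircle.prim
      rw [normPrim_congr_ae (LmCircle.coe_sub (v₁ t) (v₂ t)), normPrim_sub
        (LmCircle.intervalIntegrable _) (LmCircle.intervalIntegrable _)]
    rw [← norm_primCLM] at hb
    rw [hQ, inner_primCLM, norm_sq_primCLM, e3, e4]
    -- The rate is twice `K (1/2 + 2πM)`, with `M = 1 + K + 3Φ` taken from the second flow.
    refine (mul_le_mul_of_nonneg_left hb zero_le_two).trans_eq ?_
    ring

/-- The flow and its mirror image start at distance zero, and stability keeps them there. Then the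
primitive of the difference vanishes inside a period, and continuity and periodicity give the
identity at every point. -/
theorem ae_reflect_eq (hK : 0 ≤ K) (h : IsFlow m K u v) (heven : ∀ᵐ θ, u 0 (-θ) = u 0 θ)
    {t : ℝ} (ht : 0 ≤ t) {w F : ℝ → ℝ} (hw : IsProfile m K w F)
    (hwu : ∀ᵐ θ : ℝ, u t (θ : Circle2Pi) = w θ) (θ : ℝ) : w (-θ) = w θ := by
  have key := norm_sq_primCLM_sub_le hK h.reflect h le_rfl ht
  have h0 : LmCircle.reflection (u 0) = u 0 := by
    refine Lp.ext ?_
    filter_upwards [LmCircle.coe_reflection (u 0), heven] with x h1 h2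
    rw [h1, h2]
  rw [h0, sub_self, map_zero, norm_zero, zero_pow two_ne_zero, mul_zero, norm_sq_primCLM] at key
  set d : ℝ → ℝ := fun x => w (-x) - w x with hd
  have hdc : Continuous d := (hw.cont.comp continuous_neg).sub hw.cont
  have e1 : LmCircle.prim (LmCircle.reflection (u t) - u t) = normPrim d := by
    ext θ
    refine normPrim_congr_ae ?_ θ
    have h1 : ∀ᵐ θ : ℝ, u t ((-θ : ℝ) : Circle2Pi) = w (-θ) :=
      (Measure.measurePreserving_neg (volume : Measure ℝ)).quasiMeasurePreserving.ae hwu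
    filter_upwards [LmCircle.coe_sub (LmCircle.reflection (u t)) (u t), hwu, h1,
      LmCircle.coe_reflection_real (u t)] with x h2 h3 h4 h5
    rw [h2, h5, h3, h4]
  rw [e1] at key
  have ec : Continuous (normPrim d) := continuous_normPrim hdc.intervalIntegrable
  have hz : ∀ x ∈ Set.Ioo (0 : ℝ) (2 * π), normPrim d x = 0 := by
    intro x hx
    by_contra hne
    have : 0 < ∫ y in (0 : ℝ)..(2 * π), normPrim d y ^ 2 := by
      refine intervalIntegral.integral_pos two_pi_pos (ec.pow 2).continuousOn
        (fun y _ => sq_nonneg _) ⟨x, ⟨hx.1.le, hx.2.le⟩, by positivity⟩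
    linarith
  have hd0 : ∀ x ∈ Set.Ioo (0 : ℝ) (2 * π), d x = 0 := by
    intro x hx
    have h1 : HasDerivAt (normPrim d) 0 x := by
      refine (hasDerivAt_const x (0 : ℝ)).congr_of_eventuallyEq ?_
      filter_upwards [isOpen_Ioo.mem_nhds hx] with y hy using hz y hy
    exact (hasDerivAt_normPrim hdc x).unique h1
  have hd1 : ∀ x ∈ Set.Icc (0 : ℝ) (2 * π), d x = 0 := by
    have : Set.EqOn d (fun _ => 0) (closure (Set.Ioo 0 (2 * π))) :=
      Set.EqOn.closure (fun x hx => hd0 x hx) hdc continuous_const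
    rwa [closure_Ioo two_pi_pos.ne] at this
  have hdp : Function.Periodic d (2 * π) := hw.reflect.periodic.sub hw.periodic
  obtain ⟨y, hy, hy'⟩ := hdp.exists_mem_Ico₀ two_pi_pos θ
  have := hd1 y ⟨hy.1, hy.2.le⟩
  rw [← hy'] at this
  simp only [hd] at this
  linarith

/-- Difference quotients of `u` converge to `v t` in `L^m`, and the bounded operator `primCLM`
carries this to `H⁻¹`. -/
theorem tendsto_slope (h : IsFlow m K u v) {t : ℝ} (ht : 0 ≤ t) :
    Tendsto (fun a => (a⁻¹) ^ 2 * ‖primCLM m (u (t + a) - u t)‖ ^ 2) (𝓝[>] 0)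
      (𝓝 (‖primCLM m (v t)‖ ^ 2)) := by
  have h1 := (h.hasDerivWithinAt t ht).mono (Set.Ici_subset_Ici.2 ht)
  have h2 : HasDerivWithinAt (fun a => u (t + a)) (v t) (Set.Ioi 0) 0 := by
    have h3 : HasDerivWithinAt u (v t) (Set.Ici t) (t + id 0) := by simpa using h1
    have h4 := h3.scomp 0 ((hasDerivAt_id (0 : ℝ)).const_add t).hasDerivWithinAt
      (s := Set.Ioi 0) (fun x hx => by
        have : (0 : ℝ) < x := hx
        simp only [Set.mem_Ici]
        linarith)
    rw [one_smul] at h4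
    exact h4
  rw [hasDerivWithinAt_iff_tendsto_slope' (by simp)] at h2
  have h3 := (((primCLM m).continuous.tendsto _).comp h2).norm.pow 2
  refine h3.congr fun a => ?_
  simp only [Function.comp, slope_def_module, sub_zero, add_zero, map_smul, norm_smul, mul_pow,
    norm_inv, norm_eq_abs, inv_pow, sq_abs]

/-- The flux grows at most exponentially. -/
theorem norm_sq_flux_le (hK : 0 ≤ K) (h : IsFlow m K u v) {s t : ℝ} (hs : 0 ≤ s) (hst : s ≤ t) :
    ‖primCLM m (v t)‖ ^ 2 ≤
      exp (∫ τ in s..t, K * (1 + 4 * π * (1 + K + 3 * ‖primCLM m (v τ)‖))) *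
        ‖primCLM m (v s)‖ ^ 2 := by
  refine le_of_tendsto_of_tendsto (h.tendsto_slope (hs.trans hst))
    ((h.tendsto_slope hs).const_mul _) ?_
  filter_upwards [self_mem_nhdsWithin] with a ha
  -- The rate involves only the flux of the second flow; placing the unshifted flow there makes it
  -- independent of the shift `a`.
  have := norm_sq_primCLM_sub_le hK (h.shift (le_of_lt ha)) h hs hst
  have h2 := mul_le_mul_of_nonneg_left this (sq_nonneg a⁻¹)
  refine h2.trans_eq (by ring)

end IsFlow

/-! ### The free energy and decay of the flux -/

/-- The free energy `1/(m-1) ∫ f^m - K/2 |∫ f e^{iθ}|²`. -/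
noncomputable def freeEnergy (m K : ℝ) (f : Circle2Pi → ℝ) : ℝ :=
  (m - 1)⁻¹ * (∫ θ in (0 : ℝ)..(2 * π), f (θ : Circle2Pi) ^ m) -
    K / 2 * ((∫ θ in (0 : ℝ)..(2 * π), f (θ : Circle2Pi) * cos θ) ^ 2 +
      (∫ θ in (0 : ℝ)..(2 * π), f (θ : Circle2Pi) * sin θ) ^ 2)

/-- Convexity of the power function, in the form of Bernoulli's inequality at `a / b - 1`. -/
theorem rpow_add_mul_le_rpow {m a b : ℝ} (hm : 1 < m) (ha : 0 ≤ a) (hb : 0 ≤ b) :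
    b ^ m + m * b ^ (m - 1) * (a - b) ≤ a ^ m := by
  rcases hb.eq_or_lt with rfl | hb
  · rw [zero_rpow (by linarith), zero_rpow (by linarith)]
    simpa using rpow_nonneg ha m
  · have h1 := one_add_mul_self_le_rpow_one_add (s := a / b - 1) (p := m)
      (by have := div_nonneg ha hb.le; linarith) hm.le
    have h2 : (1 + (a / b - 1)) ^ m = a ^ m / b ^ m := by
      rw [add_sub_cancel, div_rpow ha hb.le]
    have h3 : b ^ (m - 1) = b ^ m / b := by rw [rpow_sub_one hb.ne']
    have hbm : 0 < b ^ m := by positivity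
    rw [h2, le_div_iff₀ hbm] at h1
    refine le_trans (le_of_eq ?_) h1
    rw [h3]
    field_simp

namespace IsFlow

variable {m K : ℝ} [hm : Fact (1 < m)] {u v : ℝ → LmCircle m}

theorem ae_nonneg (h : IsFlow m K u v) {t : ℝ} (ht : 0 ≤ t) : ∀ᵐ x, 0 ≤ u t x := by
  obtain ⟨w, hw, hwu⟩ := h.exists_profile t ht
  refine ae_circle_of_ae_restrict (ae_restrict_of_ae ?_)
  filter_upwards [hwu] with x hx
  rw [hx]
  exact hw.nonneg x

theorem integral_mul_congr {f : Circle2Pi → ℝ} {w : ℝ → ℝ}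
    (hwu : ∀ᵐ θ : ℝ, f (θ : Circle2Pi) = w θ) (g : ℝ → ℝ) :
    ∫ θ in (0 : ℝ)..(2 * π), f (θ : Circle2Pi) * g θ = ∫ θ in (0 : ℝ)..(2 * π), w θ * g θ :=
  intervalIntegral.integral_congr_ae (hwu.mono fun x hx _ => by rw [hx])

/-- Each first moment of a probability density is at most one in absolute value, so the interaction
part is at least `-K/2 * 2`. -/
theorem neg_le_freeEnergy (hK : 0 ≤ K) (h : IsFlow m K u v) {t : ℝ} (ht : 0 ≤ t) :
    -K ≤ freeEnergy m K (u t) := by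
  obtain ⟨w, hw, hwu⟩ := h.exists_profile t ht
  unfold freeEnergy
  rw [integral_mul_congr hwu, integral_mul_congr hwu]
  have h1 : 0 ≤ ∫ θ in (0 : ℝ)..(2 * π), u t (θ : Circle2Pi) ^ m := by
    refine intervalIntegral.integral_nonneg_of_ae two_pi_pos.le ?_
    filter_upwards [hwu] with x hx
    rw [hx]
    exact rpow_nonneg (hw.nonneg x) m
  have h2 := abs_integral_mul_le hw.cont hw.nonneg abs_cos_le_one two_pi_pos.le
  have h3 := abs_integral_mul_le hw.cont hw.nonneg abs_sin_le_one two_pi_pos.le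
  rw [hw.mass, ← sq_le_one_iff_abs_le_one] at h2 h3
  have h4 : 0 ≤ (m - 1)⁻¹ := inv_nonneg.2 (by linarith [hm.out])
  have h5 := mul_nonneg h4 h1
  nlinarith

theorem continuousOn_freeEnergy (h : IsFlow m K u v) :
    ContinuousOn (fun t => freeEnergy m K (u t)) (Set.Ici 0) := by
  obtain ⟨Tc, hTc⟩ := exists_testCLM (m := m) (g := fun θ => cos θ) (by fun_prop)
  obtain ⟨Ts, hTs⟩ := exists_testCLM (m := m) (g := fun θ => sin θ) (by fun_prop)
  have h1 := continuousOn_integral_rpow_mul h.continuousOn (fun t ht => h.ae_nonneg ht) 1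
  simp only [ContinuousMap.one_apply, mul_one, integral_circle] at h1
  unfold freeEnergy
  simp only [← hTc, ← hTs]
  exact (continuousOn_const.mul h1).sub (continuousOn_const.mul
    (((Tc.continuous.comp_continuousOn h.continuousOn).pow 2).add
      ((Ts.continuous.comp_continuousOn h.continuousOn).pow 2)))

/-- The free energy inequality. -/
theorem freeEnergy_add_integral_le (hK : 0 ≤ K) (h : IsFlow m K u v) {a b : ℝ} (ha : 0 ≤ a)
    (hab : a ≤ b) : freeEnergy m K (u b) +
      (∫ τ in a..b, ‖primCLM m (v τ)‖ ^ 2 / (1 + K + 3 * ‖primCLM m (v τ)‖)) ≤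
        freeEnergy m K (u a) := by
  have hm1 : 1 < m := hm.out
  set q : ℝ → ℝ := fun τ => ‖primCLM m (v τ)‖ ^ 2 / (1 + K + 3 * ‖primCLM m (v τ)‖) with hq
  have hqc : Continuous q := by
    have := h.continuous_velocity
    exact Continuous.div (by fun_prop) (by fun_prop) fun τ => by positivity
  obtain ⟨Tc, hTc⟩ := exists_testCLM (m := m) (g := fun θ => cos θ) (by fun_prop)
  obtain ⟨Ts, hTs⟩ := exists_testCLM (m := m) (g := fun θ => sin θ) (by fun_prop)
  have hsub : Set.Icc a b ⊆ Set.Ici 0 := fun x hx => ha.trans hx.1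
  have hQ := hasDerivAt_integral_of_continuous hqc a
  have key := le_of_touching_from_below (E := fun t => freeEnergy m K (u t) + ∫ τ in a..t, q τ) hab
    ((h.continuousOn_freeEnergy.mono hsub).add
      fun t _ => (hQ t).continuousAt.continuousWithinAt) fun t ht => ?_
  · simpa using key
  have ht0 : 0 < t := lt_of_le_of_lt ha ht.1
  obtain ⟨w, hw, hwu⟩ := h.exists_profile t ht0.le
  have wc : Continuous fun θ => w θ ^ (m - 1) := hw.cont.rpow_const fun _ => Or.inr (by linarith)
  obtain ⟨T, hT⟩ := exists_testCLM (m := m) wc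
  have hud : HasDerivAt u (v t) t := (h.hasDerivWithinAt t ht0.le).hasDerivAt (Ici_mem_nhds ht0)
  set A := ∫ θ in (0 : ℝ)..(2 * π), u t (θ : Circle2Pi) ^ m with hA
  -- Only the integral of the power is linearized, at `u t`; by convexity this touches it from
  -- below. The interaction part is a quadratic form in continuous functionals and is kept exactly.
  refine ⟨fun s => (m - 1)⁻¹ * (A + m * (T (u s) - T (u t))) -
      K / 2 * (Tc (u s) ^ 2 + Ts (u s) ^ 2) + ∫ τ in a..s, q τ,
    (m - 1)⁻¹ * (m * T (v t)) - K / 2 * (2 * Tc (u t) * Tc (v t) + 2 * Ts (u t) * Ts (v t)) + q t,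
    fun s hs => ?_, ?_, ?_, ?_⟩
  · have hs0 : 0 ≤ s := hsub hs
    unfold freeEnergy
    simp only [← hTc, ← hTs]
    have hconv : A + m * (T (u s) - T (u t)) ≤ ∫ θ in (0 : ℝ)..(2 * π), u s (θ : Circle2Pi) ^ m := by
      have i1 := (LmCircle.intervalIntegrable (u s) 0 (2 * π)).mul_continuousOn wc.continuousOn
      have i2 := (LmCircle.intervalIntegrable (u t) 0 (2 * π)).mul_continuousOn wc.continuousOn
      have i3 := intervalIntegrable_coe_circle
        (LmCircle.integrable_rpow (u t) (h.ae_nonneg ht0.le)) 0 (2 * π)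
      have i4 := intervalIntegrable_coe_circle
        (LmCircle.integrable_rpow (u s) (h.ae_nonneg hs0)) 0 (2 * π)
      rw [hT, hT, hA, ← intervalIntegral.integral_sub i1 i2, ← intervalIntegral.integral_const_mul,
        ← intervalIntegral.integral_add i3 ((i1.sub i2).const_mul m)]
      refine intervalIntegral.integral_mono_ae two_pi_pos.le (i3.add ((i1.sub i2).const_mul m)) i4 ?_
      filter_upwards [hwu, ae_coe_circle (h.ae_nonneg hs0)] with x h1 h2
      have := rpow_add_mul_le_rpow hm1 h2 (hw.nonneg x)
      rw [h1]
      linarith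
    have h4 : 0 ≤ (m - 1)⁻¹ := inv_nonneg.2 (by linarith)
    have := mul_le_mul_of_nonneg_left hconv h4
    linarith
  · simp only [sub_self, mul_zero, add_zero, freeEnergy, hTc, hTs, hA]
  · have d1 := T.hasFDerivAt.comp_hasDerivAt t hud
    have d2 := Tc.hasFDerivAt.comp_hasDerivAt t hud
    have d3 := Ts.hasFDerivAt.comp_hasDerivAt t hud
    have := (((((d1.sub_const (T (u t))).const_mul m).const_add A).const_mul (m - 1)⁻¹).sub
      (((d2.pow 2).add (d3.pow 2)).const_mul (K / 2))).add (hQ t)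
    convert! this using 1
    simp
  · have hb : ∀ θ, w θ ≤ 1 + K + 3 * ‖primCLM m (v t)‖ := by
      rw [norm_primCLM]
      exact hw.le_bound hm1 hK
    have := IsProfile.dissipation hm1 (LmCircle.intervalIntegrable (v t))
      (h.integral_velocity ht0.le) hw (by positivity) hb
    rw [← integral_mul_congr hwu, ← integral_mul_congr hwu, ← hT, ← hTc, ← hTs, ← hTc, ← hTs] at this
    have e := norm_sq_primCLM (v t)
    unfold LmCircle.prim at e
    rw [← e] at this
    have e2 : m / (m - 1) * T (v t) = (m - 1)⁻¹ * (m * T (v t)) := by ring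
    simp only [hq]
    linarith

/-- The flux tends to zero. -/
theorem tendsto_norm_flux (hK : 0 ≤ K) (h : IsFlow m K u v) :
    Tendsto (fun t => ‖primCLM m (v t)‖ ^ 2) atTop (𝓝 0) := by
  set Φ : ℝ → ℝ := fun t => ‖primCLM m (v t)‖ with hΦ
  have hΦ0 : ∀ t, 0 ≤ Φ t := fun t => norm_nonneg _
  have hΦc : Continuous Φ := by
    have := h.continuous_velocity
    fun_prop
  set q : ℝ → ℝ := fun τ => Φ τ ^ 2 / (1 + K + 3 * Φ τ) with hq
  have hM : ∀ t, 0 < 1 + K + 3 * Φ t := fun t => by linarith [hΦ0 t]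
  have hqc : Continuous q := Continuous.div (by fun_prop) (by fun_prop) fun τ => (hM τ).ne'
  have hq0 : ∀ t, 0 ≤ q t := fun t => div_nonneg (sq_nonneg _) (hM t).le
  have hE : ∀ a b, 0 ≤ a → a ≤ b → freeEnergy m K (u b) + (∫ τ in a..b, q τ) ≤ freeEnergy m K (u a) :=
    fun a b => h.freeEnergy_add_integral_le hK
  -- the energy converges
  obtain ⟨e, he⟩ : ∃ e, Tendsto (fun t => freeEnergy m K (u (max t 0))) atTop (𝓝 e) := by
    refine ⟨_, tendsto_atTop_ciInf (fun s t hst => ?_) ⟨-K, ?_⟩⟩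
    · have := hE (max s 0) (max t 0) (le_max_right _ _) (max_le_max_right 0 hst)
      have h2 : 0 ≤ ∫ τ in (max s 0)..(max t 0), q τ :=
        intervalIntegral.integral_nonneg (max_le_max_right 0 hst) fun x _ => hq0 x
      linarith
    · rintro _ ⟨t, rfl⟩
      exact h.neg_le_freeEnergy hK (le_max_right _ _)
  have hdiff : Tendsto (fun t => freeEnergy m K (u (max (t - 1) 0)) - freeEnergy m K (u (max t 0)))
      atTop (𝓝 0) := by
    have := (he.comp (tendsto_atTop_add_const_right atTop (-1 : ℝ) tendsto_id)).sub he
    simpa [Function.comp_def, ← sub_eq_add_neg] using this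
  -- This will bound the growth of `Φ ^ 2` over a time window of length at most one with total
  -- dissipation at most one.
  set C := exp (K * (1 + 4 * π * (4 * (1 + K) + 16))) with hC
  rw [Metric.tendsto_atTop]
  intro ε hε
  obtain ⟨δ, hδ0, hδ1, hδ⟩ : ∃ δ : ℝ, 0 < δ ∧ δ ≤ 1 ∧ C * (δ * (4 * (1 + K) + 16)) < ε := by
    have hD : 0 < C * (4 * (1 + K) + 16) := by positivity
    refine ⟨min 1 (ε / (2 * (C * (4 * (1 + K) + 16)))), by positivity, min_le_left _ _, ?_⟩
    have := min_le_right 1 (ε / (2 * (C * (4 * (1 + K) + 16))))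
    have h2 := mul_le_mul_of_nonneg_right this hD.le
    have h3 : ∀ D : ℝ, 0 < D → ε / (2 * D) * D = ε / 2 := fun D hD => by field_simp
    rw [h3 _ hD] at h2
    nlinarith
  obtain ⟨N, hN⟩ := (Metric.tendsto_atTop.1 hdiff) δ hδ0
  refine ⟨max N 1, fun t ht => ?_⟩
  have htN := (le_max_left _ _).trans ht
  have ht1 : 1 ≤ t := (le_max_right _ _).trans ht
  have hint : ∫ τ in (t - 1)..t, q τ ≤ δ := by
    have h1 := hN t htN
    rw [dist_zero_right, norm_eq_abs, max_eq_left (by linarith), max_eq_left (by linarith)] at h1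
    have h2 := hE (t - 1) t (by linarith) (by linarith)
    linarith [le_abs_self (freeEnergy m K (u (t - 1)) - freeEnergy m K (u t))]
  -- The window has length one, so the continuous dissipation rate cannot exceed `δ` throughout.
  obtain ⟨s, ⟨hs1, hs2⟩, hs⟩ : ∃ s ∈ Set.Icc (t - 1) t, q s ≤ δ := by
    by_contra! hcon
    have h1 : ∫ τ in (t - 1)..t, δ < ∫ τ in (t - 1)..t, q τ := by
      refine intervalIntegral.integral_lt_integral_of_continuousOn_of_le_of_exists_lt
        (by linarith) continuousOn_const hqc.continuousOn
        (fun x hx => (hcon x ⟨hx.1.le, hx.2⟩).le)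
        ⟨t, Set.right_mem_Icc.2 (by linarith), hcon t (Set.right_mem_Icc.2 (by linarith))⟩
    simp at h1
    linarith
  -- For `Φ ≤ 1 + K` the first term suffices; otherwise `1 + K + 3Φ ≤ 4Φ` and `q ≥ Φ / 4`. Thus the
  -- dissipation controls the Grönwall rate with no prior bound on `Φ`.
  have hMq : ∀ τ, 1 + K + 3 * Φ τ ≤ 4 * (1 + K) + 16 * q τ := by
    intro τ
    rcases le_total (Φ τ) (1 + K) with hle | hle
    · linarith [hq0 τ]
    · have : Φ τ / 4 ≤ q τ := by
        rw [hq]; dsimp only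
        rw [div_le_div_iff₀ (by norm_num) (hM τ)]
        nlinarith [hΦ0 τ]
      linarith
  have hexp : ∫ τ in s..t, K * (1 + 4 * π * (1 + K + 3 * Φ τ)) ≤
      K * (1 + 4 * π * (4 * (1 + K) + 16)) := by
    have h1 : ∫ τ in s..t, K * (1 + 4 * π * (1 + K + 3 * Φ τ)) ≤
        ∫ τ in (t - 1)..t, K * (1 + 4 * π * (1 + K + 3 * Φ τ)) := by
      refine intervalIntegral.integral_mono_interval hs1 hs2 le_rfl ?_
        (Continuous.intervalIntegrable (by fun_prop) _ _)
      filter_upwards with τ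
      have := hM τ
      simp only [Pi.zero_apply]
      positivity
    have h2 : ∫ τ in (t - 1)..t, K * (1 + 4 * π * (1 + K + 3 * Φ τ)) ≤
        ∫ τ in (t - 1)..t, (K * (1 + 4 * π * (4 * (1 + K))) + K * (4 * π * 16) * q τ) := by
      refine intervalIntegral.integral_mono_on (by linarith)
        (Continuous.intervalIntegrable (by fun_prop) _ _)
        (Continuous.intervalIntegrable (by fun_prop) _ _) fun τ _ => ?_
      have h3 : 0 ≤ K * (4 * π) := by positivity
      have := mul_le_mul_of_nonneg_left (hMq τ) h3
      linarith
    have h5 : ∫ τ in (t - 1)..t, (K * (1 + 4 * π * (4 * (1 + K))) + K * (4 * π * 16) * q τ) =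
        K * (1 + 4 * π * (4 * (1 + K))) + K * (4 * π * 16) * ∫ τ in (t - 1)..t, q τ := by
      rw [intervalIntegral.integral_add (by simp) ((hqc.intervalIntegrable _ _).const_mul _),
        intervalIntegral.integral_const, intervalIntegral.integral_const_mul]
      simp
    have h3 : 0 ≤ K * (4 * π * 16) := by positivity
    have h4 := mul_le_mul_of_nonneg_left (hint.trans hδ1) h3
    linarith
  have hfin := h.norm_sq_flux_le hK (by linarith : 0 ≤ s) hs2
  have hs3 : Φ s ^ 2 ≤ δ * (4 * (1 + K) + 16) := by
    have e1 : Φ s ^ 2 = q s * (1 + K + 3 * Φ s) := by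
      rw [hq]; dsimp only
      rw [div_mul_cancel₀ _ (hM s).ne']
    rw [e1]
    have := hMq s
    exact mul_le_mul hs (by linarith) (hM s).le hδ0.le
  rw [dist_zero_right, norm_of_nonneg (sq_nonneg _)]
  refine lt_of_le_of_lt (hfin.trans ?_) hδ
  exact mul_le_mul (exp_le_exp.2 hexp) hs3 (sq_nonneg _) (exp_pos _).le

end IsFlow

/-! ### Compactness and stationary limits -/

/-- Subadditivity of concave powers. With exponent `1/m` it transfers uniform convergence of the
powers `u ^ m` to the densities. -/
theorem abs_rpow_sub_rpow_le {a b p : ℝ} (ha : 0 ≤ a) (hb : 0 ≤ b) (hp : 0 ≤ p) (hp1 : p ≤ 1) :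
    |a ^ p - b ^ p| ≤ |a - b| ^ p := by
  wlog h : b ≤ a generalizing a b
  · rw [abs_sub_comm, abs_sub_comm a]
    exact this hb ha (le_of_not_ge h)
  have h1 := rpow_add_le_add_rpow hb (sub_nonneg.2 h) hp hp1
  rw [add_sub_cancel] at h1
  rw [abs_of_nonneg (sub_nonneg.2 h), abs_of_nonneg (sub_nonneg.2 (rpow_le_rpow hb h hp))]
  linarith

/-- The mean field force of an even density. -/
theorem drift_of_even {u : ℝ → ℝ} (hp : Function.Periodic u (2 * π)) (he : ∀ θ, u (-θ) = u θ)
    (K θ : ℝ) : drift K u θ = K * (∫ x in (0 : ℝ)..(2 * π), u x * cos x) * sin θ := by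
  have h := integral_comp_neg_of_periodic (g := fun x => u x * sin x) (hp.mul sin_periodic)
  simp only [he, sin_neg, mul_neg, intervalIntegral.integral_neg] at h
  have h0 : ∫ x in (0 : ℝ)..(2 * π), u x * sin x = 0 := by linarith
  unfold drift
  rw [h0]
  ring

/-- A continuous even density for which the flux vanishes identically. -/
structure IsStationaryProfile (m K : ℝ) (u : ℝ → ℝ) : Prop where
  cont : Continuous u
  periodic : Function.Periodic u (2 * π)
  nonneg : ∀ θ, 0 ≤ u θ
  mass : ∫ θ in (0 : ℝ)..(2 * π), u θ = 1
  even : ∀ θ, u (-θ) = u θ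
  hasDerivAt : ∀ θ, HasDerivAt (fun x => u x ^ m)
    (-(u θ * ((K * ∫ x in (0 : ℝ)..(2 * π), u x * cos x) * sin θ))) θ

theorem IsStationaryProfile.lift_mem_equilibriumSet {m K : ℝ} (hm : 1 < m) {w : ℝ → ℝ}
    (h : IsStationaryProfile m K w) : h.periodic.lift ∈ equilibriumSet m K := by
  set W : Circle2Pi → ℝ := h.periodic.lift with hW
  have hWc : Continuous W := continuous_coinduced_dom.2 h.cont
  have hS : Continuous sin_periodic.lift := continuous_coinduced_dom.2 continuous_sin
  have hX : cosMoment W = ∫ x in (0 : ℝ)..(2 * π), w x * cos x := rfl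
  set X := ∫ x in (0 : ℝ)..(2 * π), w x * cos x with hXd
  -- The weak derivative is read off from the equilibrium equation where `W` is positive; elsewhere
  -- zero is the right value, `W ^ (m - 1)` being constant there.
  refine ⟨⟨?_, ?_, ?_⟩, ?_, fun x => if 0 < W x then -((m - 1) / m * (K * X * sin_periodic.lift x))
    else 0, ?_, ?_, ?_⟩
  · refine Eventually.of_forall fun x => ?_
    induction x using QuotientAddGroup.induction_on with
    | H θ => exact h.nonneg θ
  · rw [integral_circle]
    exact h.mass
  · refine Eventually.of_forall fun x => ?_
    induction x using QuotientAddGroup.induction_on with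
    | H θ => exact h.even θ
  · obtain ⟨R, hR⟩ := (isCompact_univ (X := Circle2Pi)).exists_bound_of_continuousOn hWc.continuousOn
    exact memLp_top_of_bound hWc.aestronglyMeasurable R
      (Eventually.of_forall fun x => hR x (Set.mem_univ x))
  · refine memLp_top_of_bound (Measurable.aestronglyMeasurable ?_) |(m - 1) / m * (K * X)|
      (Eventually.of_forall fun x => ?_)
    · exact Measurable.ite (measurableSet_lt measurable_const hWc.measurable)
        ((hS.measurable.const_mul _).const_mul _).neg measurable_const
    · induction x using QuotientAddGroup.induction_on with
      | H θ =>
        change ‖if 0 < w θ then -((m - 1) / m * (K * X * sin θ)) else 0‖ ≤ _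
        split_ifs
        · rw [norm_neg, ← mul_assoc, norm_mul]
          exact mul_le_of_le_one_right (norm_nonneg _) (abs_sin_le_one θ)
        · rw [norm_zero]
          exact abs_nonneg _
  · intro φ hφ
    exact integral_rpow_mul_deriv_of_stationary hm h.cont h.periodic h.nonneg h.hasDerivAt hφ
  · refine Eventually.of_forall fun θ => ?_
    rw [hX]
    change w θ * (m / (m - 1) * (if 0 < w θ then -((m - 1) / m * (K * X * sin θ)) else 0) +
      K * X * sin θ) = 0
    split_ifs with h1
    · have hm0 : m ≠ 0 := by linarith
      have hm1 : m - 1 ≠ 0 := by linarith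
      field_simp
      ring
    · rw [le_antisymm (not_lt.1 h1) (h.nonneg θ), zero_mul]

/-- Compactness of even profiles with vanishing flux. -/
theorem exists_subseq_tendsto_stationary {m K : ℝ} (hm : 1 < m) (hK : 0 ≤ K) {w F : ℕ → ℝ → ℝ}
    (h : ∀ n, IsProfile m K (w n) (F n)) (he : ∀ n θ, w n (-θ) = w n θ)
    (hF : Tendsto (fun n => √(∫ x in (0 : ℝ)..(2 * π), F n x ^ 2)) atTop (𝓝 0)) :
    ∃ φ : ℕ → ℕ, StrictMono φ ∧ ∃ W, IsStationaryProfile m K W ∧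
      ∀ ε > 0, ∀ᶠ n in atTop, ∀ θ, |w (φ n) θ - W θ| ≤ ε := by
  have hm0 : 0 < m := by linarith
  have hmi : 0 ≤ m⁻¹ := by positivity
  set Φ : ℕ → ℝ := fun n => √(∫ x in (0 : ℝ)..(2 * π), F n x ^ 2) with hΦ
  obtain ⟨B, hB⟩ := hF.bddAbove_range
  have hB' : ∀ n, Φ n ≤ B := fun n => hB ⟨n, rfl⟩
  have hB0 : 0 ≤ B := (sqrt_nonneg _).trans (hB' 0)
  set R := 1 + K + 3 * B with hR
  have hR0 : 0 ≤ R := by positivity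
  have hwR : ∀ n θ, w n θ ≤ R := fun n θ => by
    have := (h n).le_bound hm hK θ
    linarith [hB' n]
  -- equicontinuity
  have hosc : ∀ n a b, a ≤ b → b ≤ a + 2 * π →
      |w n b ^ m - w n a ^ m| ≤ √(b - a) * B + K * (R * (b - a)) := by
    intro n a b hab hb
    rw [(h n).rpow_sub_rpow a b]
    refine (abs_sub _ _).trans (add_le_add ?_ ?_)
    · exact ((h n).abs_integral_flux_le hab hb).trans
        (mul_le_mul_of_nonneg_left (hB' n) (sqrt_nonneg _))
    · refine ((h n).abs_integral_mul_drift_le hK hab).trans (mul_le_mul_of_nonneg_left ?_ hK)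
      have := intervalIntegral.integral_mono_on hab ((h n).cont.intervalIntegrable a b)
        (by simp : IntervalIntegrable (fun _ => R) volume a b) fun x _ => hwR n x
      simpa [mul_comm] using this
  have hosc' : ∀ n a b, |b - a| ≤ 2 * π →
      |w n b ^ m - w n a ^ m| ≤ √|b - a| * B + K * (R * |b - a|) := by
    intro n a b hab
    rcases le_total a b with hle | hle
    · rw [abs_of_nonneg (sub_nonneg.2 hle)] at hab ⊢
      exact hosc n a b hle (by linarith)
    · rw [abs_sub_comm b a, abs_of_nonneg (sub_nonneg.2 hle)] at *
      rw [abs_sub_comm]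
      exact hosc n b a hle (by linarith)
  have hZp : ∀ n, Function.Periodic (fun θ => w n θ ^ m) (2 * π) := fun n θ => by
    simp only [(h n).periodic θ]
  -- Arzelà–Ascoli is applied to the powers `w ^ m`, whose increments are the ones controlled by the
  -- flux.
  set Z : ℕ → BoundedContinuousFunction Circle2Pi ℝ := fun n =>
    BoundedContinuousFunction.mkOfCompact
      ⟨(hZp n).lift, continuous_coinduced_dom.2 ((h n).continuous_rpow hm)⟩ with hZ
  have hcompact : IsCompact (closure (Set.range Z)) := by
    refine BoundedContinuousFunction.arzela_ascoli (Set.Icc 0 (R ^ m)) isCompact_Icc _ ?_ ?_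
    · rintro _ x ⟨n, rfl⟩
      induction x using QuotientAddGroup.induction_on with
      | H θ =>
        exact ⟨rpow_nonneg ((h n).nonneg θ) m, rpow_le_rpow ((h n).nonneg θ) (hwR n θ) hm0.le⟩
    · intro x
      induction x using QuotientAddGroup.induction_on with
      | H a =>
        rw [Metric.equicontinuousAt_iff_right]
        intro ε hε
        have hmap : 𝓝 (a : Circle2Pi) = Filter.map (fun θ : ℝ => (θ : Circle2Pi)) (𝓝 a) :=
          (QuotientAddGroup.isOpenMap_coe.map_nhds_eq (continuous_quot_mk.continuousAt)).symm
        change ∀ᶠ y in 𝓝 (a : Circle2Pi), _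
        rw [hmap, Filter.eventually_map]
        have hlim : Tendsto (fun b : ℝ => √|b - a| * B + K * (R * |b - a|)) (𝓝 a) (𝓝 0) := by
          have : Continuous fun b : ℝ => √|b - a| * B + K * (R * |b - a|) := by fun_prop
          simpa using this.tendsto a
        have hnear : ∀ᶠ b : ℝ in 𝓝 a, |b - a| < 2 * π := by
          have : Continuous fun b : ℝ => |b - a| := by fun_prop
          exact (this.tendsto a).eventually_lt_const (by simpa using two_pi_pos)
        filter_upwards [hlim.eventually_lt_const hε, hnear] with b hb1 hb2
        rintro ⟨_, n, rfl⟩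
        rw [dist_comm]
        exact (hosc' n a b hb2.le).trans_lt hb1
  obtain ⟨L, -, φ, hφ, hL⟩ := hcompact.tendsto_subseq (x := Z)
    fun n => subset_closure (Set.mem_range_self n)
  set z : ℝ → ℝ := fun θ => L (θ : Circle2Pi) with hz
  have hzc : Continuous z := L.continuous.comp (AddCircle.continuous_mk' _)
  have hzlim : ∀ θ, Tendsto (fun n => w (φ n) θ ^ m) atTop (𝓝 (z θ)) := fun θ =>
    ((continuous_eval_const (θ : Circle2Pi)).tendsto L).comp hL
  have hz0 : ∀ θ, 0 ≤ z θ := fun θ => ge_of_tendsto' (hzlim θ) fun n =>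
    rpow_nonneg ((h (φ n)).nonneg θ) m
  set W : ℝ → ℝ := fun θ => z θ ^ m⁻¹ with hW
  have hWc : Continuous W := hzc.rpow_const fun _ => Or.inr hmi
  have hWm : (fun θ => W θ ^ m) = z := funext fun θ => rpow_inv_rpow (hz0 θ) hm0.ne'
  have hunif : ∀ ε > 0, ∀ᶠ n in atTop, ∀ θ, |w (φ n) θ - W θ| ≤ ε := by
    intro ε hε
    have hεm : 0 < ε ^ m := by positivity
    filter_upwards [(Metric.tendsto_nhds.1 hL) (ε ^ m) hεm] with n hn θ
    have h1 : |w (φ n) θ ^ m - z θ| ≤ ε ^ m := by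
      have := (BoundedContinuousFunction.dist_coe_le_dist (f := Z (φ n)) (g := L)
        (θ : Circle2Pi)).trans hn.le
      exact this
    have h2 := abs_rpow_sub_rpow_le (rpow_nonneg ((h (φ n)).nonneg θ) m) (hz0 θ) hmi
      (inv_le_one_of_one_le₀ hm.le)
    rw [rpow_rpow_inv ((h (φ n)).nonneg θ) hm0.ne'] at h2
    refine h2.trans ?_
    calc |w (φ n) θ ^ m - z θ| ^ m⁻¹ ≤ (ε ^ m) ^ m⁻¹ := rpow_le_rpow (abs_nonneg _) h1 hmi
      _ = ε := rpow_rpow_inv hε.le hm0.ne'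
  have hlim : ∀ θ, Tendsto (fun n => w (φ n) θ) atTop (𝓝 (W θ)) := by
    intro θ
    rw [Metric.tendsto_nhds]
    intro ε hε
    filter_upwards [hunif (ε / 2) (by positivity)] with n hn
    exact lt_of_le_of_lt (hn θ) (by linarith)
  have hint : ∀ (g : ℝ → ℝ), Continuous g → ∀ a b : ℝ,
      Tendsto (fun n => ∫ x in a..b, w (φ n) x * g x) atTop (𝓝 (∫ x in a..b, W x * g x)) := by
    intro g hg a b
    refine tendsto_intervalIntegral_of_bounded (fun x => R * |g x|)
      (fun n => ((h (φ n)).cont.mul hg).intervalIntegrable _ _)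
      (Continuous.intervalIntegrable (by fun_prop) _ _) (fun n x => ?_)
      (fun x => (hlim x).mul_const _)
    rw [abs_mul, abs_of_nonneg ((h (φ n)).nonneg x)]
    exact mul_le_mul_of_nonneg_right (hwR _ _) (abs_nonneg _)
  have hWp : Function.Periodic W (2 * π) := fun θ => by
    refine tendsto_nhds_unique (hlim (θ + 2 * π)) ?_
    simpa only [(h _).periodic θ] using hlim θ
  refine ⟨φ, hφ, W, ⟨hWc, hWp, fun θ => rpow_nonneg (hz0 θ) _, ?_, fun θ => ?_, fun θ => ?_⟩, hunif⟩
  · have h1 := hint (fun _ => 1) continuous_const 0 (2 * π)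
    simp only [mul_one, (h _).mass] at h1
    exact tendsto_nhds_unique h1 tendsto_const_nhds
  · refine tendsto_nhds_unique (hlim (-θ)) ?_
    simpa only [he] using hlim θ
  · set X := ∫ x in (0 : ℝ)..(2 * π), W x * cos x with hX
    -- The limit is taken in the integrated equation, where the flux integral disappears;
    -- derivatives need not converge.
    have heq : ∀ a b, a ≤ b → b ≤ a + 2 * π →
        z b = z a + ∫ x in a..b, -(W x * (K * X * sin x)) := by
      intro a b hab hb
      have hflux : Tendsto (fun n => ∫ x in a..b, F (φ n) x) atTop (𝓝 0) := by
        have h1 : Tendsto (fun n => √(b - a) * Φ (φ n)) atTop (𝓝 0) := by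
          simpa using (hF.comp hφ.tendsto_atTop).const_mul √(b - a)
        exact squeeze_zero_norm (fun n => (h (φ n)).abs_integral_flux_le hab hb) h1
      have hdr : Tendsto (fun n => ∫ x in a..b, w (φ n) x * drift K (w (φ n)) x) atTop
          (𝓝 (K * X * ∫ x in a..b, W x * sin x)) := by
        have h1 := ((hint cos continuous_cos 0 (2 * π)).const_mul K).mul
          (hint sin continuous_sin a b)
        refine h1.congr fun n => ?_
        simp only [drift_of_even (h (φ n)).periodic (he (φ n))]
        rw [← intervalIntegral.integral_const_mul (K * _)]
        refine intervalIntegral.integral_congr fun x _ => ?_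
        ring
      have h1 := (hzlim b).sub (hzlim a)
      simp only [(h _).rpow_sub_rpow a b] at h1
      have h2 := tendsto_nhds_unique h1 (hflux.sub hdr)
      have h3 : ∫ x in a..b, -(W x * (K * X * sin x)) = -(K * X * ∫ x in a..b, W x * sin x) := by
        rw [← intervalIntegral.integral_const_mul (K * X), ← intervalIntegral.integral_neg]
        refine intervalIntegral.integral_congr fun x _ => ?_
        ring
      rw [h3]
      linarith
    rw [hWm]
    have hc : Continuous fun x => -(W x * (K * X * sin x)) := by fun_prop
    refine ((hasDerivAt_integral_of_continuous hc (θ - 1) θ).const_add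
      (z (θ - 1))).congr_of_eventuallyEq ?_
    -- A window of length two about `θ` fits in one period, as the integrated identity requires.
    filter_upwards [Ioo_mem_nhds (show θ - 1 < θ by linarith) (show θ < θ + 1 by linarith)]
      with y hy
    exact heq _ _ hy.1.le (by linarith [hy.2, pi_gt_three])

/-! ### Convergence to the equilibrium set -/

theorem theorem2 (m K : ℝ) [Fact (1 < m)] (hK : 0 ≤ K)
    (u : ℝ → LmCircle m)
    (hC1 : ContDiffOn ℝ 1 u (Set.Ici 0))
    (hsol : IsWeakSolution m K u)
    (hnonneg : ∀ t : ℝ, 0 ≤ t → ∀ᵐ θ, 0 ≤ u t θ)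
    (hmass : ∀ t : ℝ, 0 ≤ t → ∫ θ, u t θ = 1)
    (heven : ∀ᵐ θ, u 0 (-θ) = u 0 θ) :
    Tendsto (fun t : ℝ => ⨅ w ∈ equilibriumSet m K, eLpNorm (fun θ => u t θ - w θ) ⊤ volume)
      atTop (𝓝 0) := by
  have hm : 1 < m := Fact.out
  obtain ⟨v, hflow⟩ := IsWeakSolution.exists_isFlow hC1 hsol hnonneg hmass
  -- It suffices to find, in every sequence of times tending to infinity, a subsequence along which
  -- the distance tends to zero.
  refine tendsto_of_subseq_tendsto fun τ hτ => ?_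
  -- Early terms of the sequence may be negative; truncation does not affect the late ones.
  have hmax : ∀ n, 0 ≤ max (τ n) 0 := fun n => le_max_right _ _
  choose w hw hwu using fun n => hflow.exists_profile (max (τ n) 0) (hmax n)
  have hτ' : Tendsto (fun n => max (τ n) 0) atTop atTop :=
    tendsto_atTop_mono (fun n => le_max_left _ _) hτ
  have hflux : Tendsto (fun n => √(∫ x in (0 : ℝ)..(2 * π),
      LmCircle.prim (v (max (τ n) 0)) x ^ 2)) atTop (𝓝 0) := by
    have := ((hflow.tendsto_norm_flux hK).comp hτ').sqrt
    simpa only [Function.comp_def, norm_sq_primCLM, sqrt_zero] using this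
  obtain ⟨φ, hφ, W, hW, hunif⟩ := exists_subseq_tendsto_stationary hm hK hw
    (fun n θ => hflow.ae_reflect_eq hK heven (hmax n) (hw n) (hwu n) θ) hflux
  refine ⟨φ, ?_⟩
  rw [ENNReal.tendsto_nhds_zero]
  intro ε hε
  obtain ⟨δ, hδ0, hδ⟩ : ∃ δ : ℝ, 0 < δ ∧ ENNReal.ofReal δ ≤ ε := by
    rcases eq_or_ne ε ⊤ with rfl | hne
    · exact ⟨1, one_pos, le_top⟩
    · exact ⟨ε.toReal, ENNReal.toReal_pos hε.ne' hne, (ENNReal.ofReal_toReal hne).le⟩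
  filter_upwards [hunif δ hδ0, (hτ.comp hφ.tendsto_atTop).eventually_ge_atTop 0] with n hn hn0
  refine (iInf₂_le _ (hW.lift_mem_equilibriumSet hm)).trans (le_trans ?_ hδ)
  rw [eLpNorm_exponent_top]
  refine eLpNormEssSup_le_of_ae_bound (ae_circle_of_ae_restrict (ae_restrict_of_ae ?_))
  have hwn := hwu (φ n)
  rw [max_eq_left (show 0 ≤ τ (φ n) from hn0)] at hwn
  filter_upwards [hwn] with θ hθ
  rw [hθ]
  exact hn θ
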